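/- **Proposition 7.1 (backwards stability).** Let $n\ge 2$. *Necks.* Let $\mathcal M=\{M_t\}$ be a family of subsets of $\mathbb R^{n+1}$. We say that $\mathcal M$ has a *strong $\varepsilon$-neck* with center $p$ and radius $r>0$ at time $t_0$ if, for some rotation $O$ of $\mathbb R^{n+1}$, the rescaled flow $N_s=r^{-1}(M_{t_0+r^2s}-p)$, $s\in(-1,0]$, is $\varepsilon$-close in the $C^{\lfloor 1/\varepsilon\rfloor}$ sense in $B_{1/\varepsilon}(0)\times(-1,0]$ to the shrinking cylinders $$\Sigma_s=O\big(S^{n-1}(\sqrt{1-2(n-1)s})\times\mathbb R\big),$$ where $S^{n-1}(\rho)$ is the round sphere of radius $\rho$ in $\mathbb R^n$. This means that there is a function $u(s,y)$, $s\in(-1,0]$, $y\in\Sigma_s$, such that for every $s$ one has $N_s\cap B_{1/\varepsilon}(0)=\{y+u(s,y)\nu_s(y):y\in\Sigma_s\}\cap B_{1/\varepsilon}(0)$, with $\nu_s$ the outward unit normal of $\Sigma_s$, and such that $u$ is $C^{\lfloor 1/\varepsilon\rfloor}$ in space-time with all derivatives of order at most $\lfloor 1/\varepsilon\rfloor$ (including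 order $0$) bounded by $\varepsilon$ at every $(s,y)$ for which $y$ or $y+u(s,y)\nu_s(y)$ lies in $B_{1/\varepsilon}(0)$. (Derivatives of $u$ are those of its extension to a neighbourhood in space-time that is constant along the normal lines of each $\Sigma_s$, one-sided in time at $s=0$; norms are operator norms, with $|(s,x)|=\max(|s|,|x|)$ on $\mathbb R\times\mathbb R^{n+1}$.) *Flows.* A *cylindrical flow* is, up to rigid motions of $\mathbb R^{n+1}$ and translations in time, the shrinking cylinder $M_t=S^{n-1}(\sqrt{-2(n-1)t})\times\mathbb R$, $t<0$ (with $M_t=\emptyset$ for $t\ge 0$). A *translating bowl soliton* is, up to rigid motions, the flow $M_t=\operatorname{graph}(\psi)+c\,t\,e_{n+1}$, $t\in\mathbb R$, where $c>0$ and $\psi:\mathbb R^n\to\mathbb R$ is smooth, rotationally symmetric and strictly convex and satisfies the translator equation $$\Delta\psi-\frac{D^2\psi(\nabla\psi,\nabla\psi)}{1+|\nabla\psi|^2}=c .$$ *Claim.* There is $\bar\delta=\bar\delta(n)>0$ such that for all $\delta_0,\delta_1\in(0,\bar\delta]$ there is $\mathcal T=\mathcal T(n,\delta_0,\delta_1)\in(0,\infty)$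 with the following property. If $\mathcal M$ is a cylindrical flow or a translating bowl soliton in $\mathbb R^{n+1}$ and $\mathcal M$ has a strong $\delta_0$-neck with center $p$ and radius $\sqrt{2(n-1)}$ at time $-1$, then for every $t\in(-\infty,-\mathcal T]$ the flow $\mathcal M$ has a strong $\delta_1$-neck with center $p$ and radius $\sqrt{2(n-1)|t|}$ at time $t$. -/

import Mathlib

open Set
open scoped ContDiff

noncomputable section

/-- Euclidean space `ℝ^m`. -/
abbrev Euc (m : ℕ) : Type := EuclideanSpace ℝ (Fin m)

/-- The component of `x` orthogonal to the unit vector `w`. -/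
def radialPart {m : ℕ} (w x : Euc m) : Euc m := x - inner ℝ w x • w

/-- The round cylinder `O(S^{m-2}(ρ) × ℝ) ⊆ ℝ^m` of radius `ρ` around the line `ℝ w`, where `w` is
a unit vector; here `O` is any rotation that takes the last basis vector to `w`. -/
def roundCylinder {m : ℕ} (w : Euc m) (ρ : ℝ) : Set (Euc m) := {x | ‖radialPart w x‖ = ρ}

/-- The outward unit normal of the round cylinders around `ℝ w`, at any point off the axis. -/
def cylNormal {m : ℕ} (w x : Euc m) : Euc m := ‖radialPart w x‖⁻¹ • radialPart w x

/-- The nearest point projection onto `roundCylinder w ρ`, at any point off the axis. -/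
def cylProj {m : ℕ} (w : Euc m) (ρ : ℝ) (x : Euc m) : Euc m :=
  inner ℝ w x • w + ρ • cylNormal w x

/-- Radius at time `s` of the shrinking cylinder `S^{n-1}(√(1 - 2(n-1)s)) × ℝ` that has radius `1`
at time `0`. -/
def modelRadius (n : ℕ) (s : ℝ) : ℝ := √(1 - 2 * ((n : ℝ) - 1) * s)

/-- The function `(s, x) ↦ u(s, π_s(x))` on space-time, where `π_s` is the nearest point projection
onto the model cylinder `Σ_s` at time `s`. It extends `u(s, ·)` from `Σ_s`, constantly along the
normal lines of `Σ_s`, and only depends on the values of `u(s, ·)` on `Σ_s`. Its derivatives at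
points of `Σ_s` serve to measure the `C^k` size of `u`. -/
def normalExtension (n : ℕ) (w : Euc (n + 1)) (u : ℝ → Euc (n + 1) → ℝ) : ℝ × Euc (n + 1) → ℝ :=
  fun q => u q.1 (cylProj w (modelRadius n q.1) q.2)

/-- The family of sets `N_s`, `s ∈ (-1, 0]`, is `ε`-close in `C^{⌊1/ε⌋}` in
`B_{1/ε}(0) × (-1, 0]` to the shrinking cylinders `Σ_s = O(S^{n-1}(√(1 - 2(n-1)s)) × ℝ)` with
axis `ℝ w`: inside the ball `B_{1/ε}(0)` the set `N_s` is the normal graph of a function `u(s, ·)`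
over `Σ_s`, and all derivatives of `u` in space-time up to order `⌊1/ε⌋` are bounded by `ε`
wherever the base point or the graph point lies in the ball. -/
def IsCloseToCylinder (n : ℕ) (ε : ℝ) (w : Euc (n + 1)) (N : ℝ → Set (Euc (n + 1))) : Prop :=
  ∃ u : ℝ → Euc (n + 1) → ℝ,
    ∀ s ∈ Ioc (-1 : ℝ) 0,
      N s ∩ Metric.ball 0 ε⁻¹ =
        ((fun y => y + u s y • cylNormal w y) '' roundCylinder w (modelRadius n s)) ∩
          Metric.ball 0 ε⁻¹ ∧
      ∀ y ∈ roundCylinder w (modelRadius n s),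
        (y ∈ Metric.ball (0 : Euc (n + 1)) ε⁻¹ ∨
          y + u s y • cylNormal w y ∈ Metric.ball (0 : Euc (n + 1)) ε⁻¹) →
        ContDiffWithinAt ℝ (⌊ε⁻¹⌋₊ : ℕ) (normalExtension n w u) (Ioc (-1 : ℝ) 0 ×ˢ univ) (s, y) ∧
        ∀ j : ℕ, j ≤ ⌊ε⁻¹⌋₊ →
          ‖iteratedFDerivWithin ℝ j (normalExtension n w u) (Ioc (-1 : ℝ) 0 ×ˢ univ) (s, y)‖ ≤ ε

/-- The flow `M_t` of subsets of `ℝ^{n+1}` has a strong `ε`-neck with center `p` and radius `r` at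
time `t₀`: the rescaled flow `r⁻¹ (M_{t₀ + r² s} - p)`, `s ∈ (-1, 0]`, is `ε`-close to the shrinking
cylinders of radius `√(1 - 2(n-1)s)` around some line through the origin. -/
def HasStrongNeck (n : ℕ) (ε : ℝ) (M : ℝ → Set (Euc (n + 1))) (p : Euc (n + 1)) (r t₀ : ℝ) :
    Prop :=
  0 < r ∧ ∃ w : Euc (n + 1), ‖w‖ = 1 ∧
    IsCloseToCylinder n ε w
      (fun s => (fun x => r⁻¹ • (x - p)) '' M (t₀ + r ^ 2 * s))

/-- `M` is a round shrinking cylinder flow in `ℝ^{n+1}` with one `ℝ`-factor, up to rigid motions and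
translations in time: it becomes extinct at time `T`, its axis is the line `q + ℝ w`, and `M_t` has
radius `√(2(n-1)(T - t))` for `t < T`. -/
def IsCylinderFlow (n : ℕ) (M : ℝ → Set (Euc (n + 1))) : Prop :=
  ∃ (T : ℝ) (q w : Euc (n + 1)), ‖w‖ = 1 ∧
    ∀ t, M t = {x | t < T ∧ x - q ∈ roundCylinder w √(2 * ((n : ℝ) - 1) * (T - t))}

/-- The operator `Δψ - D²ψ(∇ψ, ∇ψ) / (1 + |∇ψ|²) = √(1 + |∇ψ|²) div (∇ψ / √(1 + |∇ψ|²))`. The graphs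
of `ψ(·, t)` move by mean curvature if and only if `∂ψ/∂t` equals this operator applied to `ψ`. -/
def graphMCFOperator {n : ℕ} (ψ : Euc n → ℝ) (x : Euc n) : ℝ :=
  Laplacian.laplacian ψ x -
    iteratedFDeriv ℝ 2 ψ x ![gradient ψ x, gradient ψ x] / (1 + ‖gradient ψ x‖ ^ 2)

/-- `φ` is the profile of a bowl soliton of speed `c`: the function `ψ(x) = φ(|x|)` on `ℝ^n` is
smooth and strictly convex, and its graph moves by mean curvature by translation with velocity
`c` in the vertical direction. -/
structure IsBowlProfile (n : ℕ) (c : ℝ) (φ : ℝ → ℝ) : Prop where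
  speed_pos : 0 < c
  smooth : ContDiff ℝ ∞ (fun x : Euc n => φ ‖x‖)
  strictConvex : StrictConvexOn ℝ univ (fun x : Euc n => φ ‖x‖)
  translator : ∀ x : Euc n, graphMCFOperator (fun x : Euc n => φ ‖x‖) x = c

/-- `M` is a translating bowl soliton in `ℝ^{n+1}`, of any speed `c > 0`, up to rigid motions: in
direction `w` over the hyperplane through `q` orthogonal to `w`, the set `M_t` is the graph of
`φ(|·|) + c t`. -/
def IsBowlFlow (n : ℕ) (M : ℝ → Set (Euc (n + 1))) : Prop :=
  ∃ (c : ℝ) (φ : ℝ → ℝ) (q w : Euc (n + 1)), IsBowlProfile n c φ ∧ ‖w‖ = 1 ∧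
    ∀ t, M t = {x | inner ℝ w (x - q) = φ ‖radialPart w (x - q)‖ + c * t}

end

/-!
A neck on a cylindrical flow or a bowl soliton pins down the position and the scale of the flow
relative to the center of the neck; going back in time, the flow rescaled around the center then
converges smoothly to the shrinking cylinder, uniformly over all such flows.

*Position and scale.* Only the time slice `s = 0` of the given neck is used. It is the zero set of a
convex function `f`: the distance to the axis minus the radius for a cylinder, and
`φ(|x'|) + c t - x_{n+1}` for a bowl soliton. By convexity `f` is negative inside the neck and
positive outside. As `f` does not increase along the axis `w` of the flow, `w` is almost parallel to
the axis of the neck (`IsCloseToCylinder.control`). This bounds the distance of the center from the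
axis of the flow, the extinction time of a cylinder, and for a bowl soliton the height above the
tip; it also bounds the speed `c` from below (`HasStrongNeck.cylinder_control`,
`HasStrongNeck.bowl_control`).

*Asymptotics of the bowl.* The derivative `v` of the profile solves
`v' = (1 + v²) (c - (n - 1) v / r)`, `v(0) = 0`, and a Gronwall argument shows uniqueness. So all bowl
solitons are rescalings of a single one. For speed `1` let `F` be its squared radius as a function of
the height `y`. Then `D = F' - 2 (n - 1)` solves the damped equation
`D' = -(1 + F'² / (4 F)) D + F'² / (2 F)`, which gives `D^{(j)} = O(y^{-1-j})` for all `j`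
(`IsBowlCurve.isSymbol_slopeError`): differentiation preserves the damping, and the coefficients
behave like symbols, gaining a power of `y` with each derivative. Consequently the rescaled functions
`μ² F(τ / μ²)` converge to `2 (n - 1) τ` with all derivatives as `μ → 0`.

*Convergence.* At time `t` and scale `λ = √(2 (n - 1) |t|)` the flow is a hypersurface of revolution
whose squared radius at height `z` and time `s` is `1 - 2 (n - 1) s`, up to a shift of order `λ⁻²`, a
slope `μ = 1 / (c λ)` (or `0`) and an error as above, and whose axis is at distance of order `λ⁻¹`
from the center. Its height over the shrinking cylinder is an explicit expression in these data
(`neckGraph`), so it tends to zero with all derivatives (`isCkNull_neckGraph`).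
-/

open Filter Topology Asymptotics

/-! ### Symbol classes and damped linear equations -/

/-- `IsSymbol k m f` : the derivatives of `f` up to order `k` satisfy `f^{(j)} = O(h^{m-j})` as
`h → ∞`. -/
def IsSymbol : ℕ → ℤ → (ℝ → ℝ) → Prop
  | 0, m, f => f =O[atTop] fun h : ℝ => h ^ m
  | k + 1, m, f => (f =O[atTop] fun h : ℝ => h ^ m) ∧ IsSymbol k (m - 1) (deriv f)

namespace IsSymbol

theorem isBigO {k : ℕ} {m : ℤ} {f : ℝ → ℝ} (hf : IsSymbol k m f) :
    f =O[atTop] fun h : ℝ => h ^ m := by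
  cases k with
  | zero => exact hf
  | succ k => exact hf.1

theorem congr {k : ℕ} {m : ℤ} {f g : ℝ → ℝ} (hf : IsSymbol k m f) (h : EqOn f g (Ioi 0)) :
    IsSymbol k m g := by
  induction k generalizing m f g with
  | zero => exact hf.congr' ((eventually_gt_atTop 0).mono fun x hx => h hx) EventuallyEq.rfl
  | succ k ih =>
    refine ⟨hf.1.congr' ((eventually_gt_atTop 0).mono fun x hx => h hx) EventuallyEq.rfl,
      ih hf.2 fun x hx => ?_⟩
    exact (h.eventuallyEq_of_mem (Ioi_mem_nhds hx)).deriv_eq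

theorem pred {k : ℕ} {m : ℤ} {f : ℝ → ℝ} (hf : IsSymbol (k + 1) m f) : IsSymbol k m f := by
  induction k generalizing m f with
  | zero => exact hf.1
  | succ k ih => exact ⟨hf.1, ih hf.2⟩

theorem weaken {k : ℕ} {m m' : ℤ} {f : ℝ → ℝ} (hf : IsSymbol k m f) (hm : m ≤ m') :
    IsSymbol k m' f := by
  have key : ∀ a b : ℤ, a ≤ b → (fun h : ℝ => h ^ a) =O[atTop] fun h : ℝ => h ^ b := by
    intro a b hab
    refine IsBigO.of_bound 1 ?_
    filter_upwards [eventually_ge_atTop 1] with h hh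
    rw [one_mul, Real.norm_of_nonneg (by positivity), Real.norm_of_nonneg (by positivity)]
    exact zpow_le_zpow_right₀ hh hab
  induction k generalizing m m' f with
  | zero => exact IsBigO.trans hf (key _ _ hm)
  | succ k ih => exact ⟨hf.1.trans (key _ _ hm), ih hf.2 (by lia)⟩

theorem const (k : ℕ) (c : ℝ) : IsSymbol k 0 fun _ => c := by
  have zero : ∀ k m, IsSymbol k m fun _ => (0 : ℝ) := by
    intro k
    induction k with
    | zero => exact fun m => isBigO_zero _ _
    | succ k ih =>
      intro m
      refine ⟨isBigO_zero _ _, ?_⟩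
      simpa using ih (m - 1)
  have h0 : (fun _ : ℝ => c) =O[atTop] fun h : ℝ => h ^ (0 : ℤ) := by
    simpa using isBigO_const_const c (one_ne_zero (α := ℝ)) (atTop : Filter ℝ)
  cases k with
  | zero => exact h0
  | succ k => exact ⟨h0, by simpa using zero k _⟩

theorem add {k : ℕ} {m : ℤ} {f g : ℝ → ℝ} (hf : IsSymbol k m f) (hg : IsSymbol k m g)
    (sf : ContDiffOn ℝ ∞ f (Ioi 0)) (sg : ContDiffOn ℝ ∞ g (Ioi 0)) :
    IsSymbol k m fun h => f h + g h := by
  induction k generalizing m f g with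
  | zero => exact IsBigO.add hf hg
  | succ k ih =>
    have sf' := (contDiffOn_infty_iff_deriv_of_isOpen isOpen_Ioi).1 sf
    have sg' := (contDiffOn_infty_iff_deriv_of_isOpen isOpen_Ioi).1 sg
    refine ⟨hf.1.add hg.1, (ih hf.2 hg.2 sf'.2 sg'.2).congr fun x hx => ?_⟩
    exact (deriv_add (sf'.1.differentiableAt (Ioi_mem_nhds hx))
      (sg'.1.differentiableAt (Ioi_mem_nhds hx))).symm

theorem mul {k : ℕ} {m m' : ℤ} {f g : ℝ → ℝ} (hf : IsSymbol k m f) (hg : IsSymbol k m' g)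
    (sf : ContDiffOn ℝ ∞ f (Ioi 0)) (sg : ContDiffOn ℝ ∞ g (Ioi 0)) :
    IsSymbol k (m + m') fun h => f h * g h := by
  have key : ∀ {m m' : ℤ} {f g : ℝ → ℝ}, (f =O[atTop] fun h : ℝ => h ^ m) →
      (g =O[atTop] fun h : ℝ => h ^ m') →
      (fun h => f h * g h) =O[atTop] fun h : ℝ => h ^ (m + m') := by
    intro m m' f g hf hg
    refine (hf.mul hg).congr' EventuallyEq.rfl ?_
    filter_upwards [eventually_gt_atTop 0] with h hh
    rw [zpow_add₀ hh.ne']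
  induction k generalizing m m' f g with
  | zero => exact key hf hg
  | succ k ih =>
    have sf' := (contDiffOn_infty_iff_deriv_of_isOpen isOpen_Ioi).1 sf
    have sg' := (contDiffOn_infty_iff_deriv_of_isOpen isOpen_Ioi).1 sg
    refine ⟨key hf.1 hg.1, ?_⟩
    have h1 := ih hf.2 hg.pred sf'.2 sg
    have h2 := ih hf.pred hg.2 sf sg'.2
    rw [show m - 1 + m' = m + m' - 1 by ring] at h1
    rw [show m + (m' - 1) = m + m' - 1 by ring] at h2
    refine (h1.add h2 (sf'.2.mul sg) (sf.mul sg'.2)).congr fun x hx => ?_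
    exact (deriv_mul (sf'.1.differentiableAt (Ioi_mem_nhds hx))
      (sg'.1.differentiableAt (Ioi_mem_nhds hx))).symm

theorem iteratedDeriv_isBigO {k : ℕ} {m : ℤ} {f : ℝ → ℝ} (hf : IsSymbol k m f) :
    iteratedDeriv k f =O[atTop] fun h : ℝ => h ^ (m - k) := by
  induction k generalizing m f with
  | zero => simpa using hf.isBigO
  | succ k ih =>
    rw [iteratedDeriv_succ', show m - ((k + 1 : ℕ) : ℤ) = m - 1 - k by push_cast; ring]
    exact ih hf.2

end IsSymbol

/-- A solution of the damped equation `y' = -A y + b` cannot leave the interval `[-M, M]` if it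
starts there and `|b| ≤ M A`. -/
theorem abs_le_of_deriv_eq_damped {y A b : ℝ → ℝ} {h₀ M : ℝ}
    (hy : ∀ h ≥ h₀, HasDerivAt y (-(A h * y h) + b h) h) (hA : ∀ h ≥ h₀, 0 < A h)
    (hb : ∀ h ≥ h₀, |b h| ≤ M * A h) (h0 : |y h₀| ≤ M) : ∀ h ≥ h₀, |y h| ≤ M := by
  have key : ∀ {y b : ℝ → ℝ}, (∀ h ≥ h₀, HasDerivAt y (-(A h * y h) + b h) h) →
      (∀ h ≥ h₀, |b h| ≤ M * A h) → |y h₀| ≤ M → ∀ h ≥ h₀, y h ≤ M := by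
    intro y b hy hb h0 h hh
    refine le_of_forall_pos_le_add fun ε hε => ?_
    refine image_le_of_deriv_right_lt_deriv_boundary' (a := h₀) (b := h) (f := y)
      (f' := fun h => -(A h * y h) + b h) (B := fun _ => M + ε) (B' := fun _ => 0)
      (fun x hx => (hy x hx.1).continuousAt.continuousWithinAt)
      (fun x hx => (hy x hx.1).hasDerivWithinAt) (by linarith [le_abs_self (y h₀)])
      continuousOn_const (fun x _ => hasDerivWithinAt_const _ _ _) (fun x hx hxy => ?_)
      (right_mem_Icc.2 hh)
    have h1 := (abs_le.1 (hb x hx.1)).2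
    have h2 := mul_pos (hA x hx.1) hε
    have hxy : y x = M + ε := hxy
    simp only [hxy]
    nlinarith
  intro h hh
  refine abs_le.2 ⟨?_, key hy hb h0 h hh⟩
  have := key (y := fun h => -y h) (b := fun h => -b h)
    (fun h hh => (hy h hh).neg.congr_deriv (by ring)) (by simpa using hb) (by simpa using h0) h hh
  linarith

/-- If `y' = -A y + b` with `A` bounded below, then `y` decays at the same rate as `b`: after
multiplication by `h^{-m}` the damping factor changes only by `m / h`. -/
theorem isBigO_zpow_of_damped {y A b : ℝ → ℝ} {m : ℤ}
    (hy : ∀ᶠ h in atTop, HasDerivAt y (-(A h * y h) + b h) h)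
    (hA : ∀ᶠ h in atTop, 1 / 2 ≤ A h) (hb : b =O[atTop] fun h : ℝ => h ^ m) :
    y =O[atTop] fun h : ℝ => h ^ m := by
  obtain ⟨B, hB0, hB⟩ := hb.exists_pos
  obtain ⟨h₀, H⟩ := eventually_atTop.1 (hy.and (hA.and (hB.bound.and
    ((eventually_gt_atTop (0 : ℝ)).and (eventually_ge_atTop (4 * |(m : ℝ)|))))))
  set M := max |y h₀ * h₀ ^ (-m)| (4 * B) with hM
  have main : ∀ h ≥ h₀, |y h * h ^ (-m)| ≤ M := by
    refine abs_le_of_deriv_eq_damped (A := fun h => A h + m / h) (b := fun h => b h * h ^ (-m))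
      ?_ ?_ ?_ (le_max_left _ _)
    · intro h hh
      obtain ⟨h1, -, -, hpos, -⟩ := H h hh
      refine (h1.mul (hasDerivAt_zpow (-m) h (Or.inl hpos.ne'))).congr_deriv ?_
      rw [zpow_sub_one₀ hpos.ne']
      push_cast
      field_simp
      ring
    all_goals
      intro h hh
      obtain ⟨-, h2, h3, hpos, h4⟩ := H h hh
      have h5 : -(1 / 4) ≤ m / h := by
        rw [le_div_iff₀ hpos]
        linarith [neg_abs_le (m : ℝ)]
    · linarith
    · have h6 : |b h * h ^ (-m)| ≤ B := by
        rw [Real.norm_eq_abs, Real.norm_of_nonneg (by positivity)] at h3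
        rw [abs_mul, abs_of_pos (zpow_pos hpos (-m)), zpow_neg, ← div_eq_mul_inv,
          div_le_iff₀ (zpow_pos hpos m)]
        exact h3
      have h7 : 4 * B ≤ M := le_max_right _ _
      have h8 : (1 / 4 : ℝ) ≤ A h + m / h := by linarith
      nlinarith
  refine IsBigO.of_bound M ?_
  filter_upwards [eventually_ge_atTop h₀] with h hh
  have hpos := (H h hh).2.2.2.1
  have := main h hh
  rw [abs_mul, abs_of_pos (zpow_pos hpos (-m)), zpow_neg, ← div_eq_mul_inv,
    div_le_iff₀ (zpow_pos hpos m)] at this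
  rwa [Real.norm_eq_abs, Real.norm_of_nonneg (by positivity)]

/-- Damped linear equations `y' = -A y + b` preserve symbol classes: differentiating, `y'` solves
an equation of the same kind with the right-hand side `b' - A' y`, which is one order smaller. -/
theorem IsSymbol.of_damped {k : ℕ} {m : ℤ} {y A b : ℝ → ℝ}
    (hy : ∀ h > 0, HasDerivAt y (-(A h * y h) + b h) h)
    (sy : ContDiffOn ℝ ∞ y (Ioi 0)) (sA : ContDiffOn ℝ ∞ A (Ioi 0))
    (sb : ContDiffOn ℝ ∞ b (Ioi 0))
    (hA : ∀ᶠ h in atTop, 1 / 2 ≤ A h) (kA : IsSymbol k 0 A) (kb : IsSymbol k m b) :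
    IsSymbol k m y := by
  induction k generalizing m y b with
  | zero => exact isBigO_zpow_of_damped ((eventually_gt_atTop 0).mono hy) hA kb
  | succ k ih =>
    have dy := (contDiffOn_infty_iff_deriv_of_isOpen isOpen_Ioi).1 sy
    have dA := (contDiffOn_infty_iff_deriv_of_isOpen isOpen_Ioi).1 sA
    have db := (contDiffOn_infty_iff_deriv_of_isOpen isOpen_Ioi).1 sb
    have ky := ih hy sy sb kA.pred kb.pred
    refine ⟨isBigO_zpow_of_damped ((eventually_gt_atTop 0).mono hy) hA kb.1, ?_⟩
    have s1 : ContDiffOn ℝ ∞ (fun h => (-1) * (deriv A h * y h)) (Ioi 0) :=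
      contDiffOn_const.mul (dA.2.mul sy)
    refine ih (b := fun h => deriv b h + (-1) * (deriv A h * y h)) ?_ dy.2 (db.2.add s1) kA.pred
      (kb.2.add ?_ db.2 s1)
    · intro h hh
      have e : deriv y =ᶠ[𝓝 h] fun h => -(A h * y h) + b h :=
        Filter.eventually_of_mem (Ioi_mem_nhds hh) fun x hx => (hy x hx).deriv
      refine HasDerivAt.congr_of_eventuallyEq ?_ e
      have a1 := (dA.1.differentiableAt (Ioi_mem_nhds hh)).hasDerivAt
      have b1 := (db.1.differentiableAt (Ioi_mem_nhds hh)).hasDerivAt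
      have y1 := (dy.1.differentiableAt (Ioi_mem_nhds hh)).hasDerivAt
      exact ((a1.mul y1).neg.add b1).congr_deriv (by ring)
    · have := (IsSymbol.const k (-1)).mul (kA.2.mul ky dA.2 sy) contDiffOn_const (dA.2.mul sy)
      rwa [show (0 : ℤ) + (0 - 1 + m) = m - 1 by ring] at this

/-! ### The profile curve of the bowl soliton -/

/-- `f` is smooth on `(0, ∞)` and its derivatives up to order `k` satisfy `f^{(j)} = O(h^{m-j})` as
`h → ∞`. -/
structure IsSmoothSymbol (k : ℕ) (m : ℤ) (f : ℝ → ℝ) : Prop where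
  smooth : ContDiffOn ℝ ∞ f (Ioi 0)
  symbol : IsSymbol k m f

namespace IsSmoothSymbol

variable {k : ℕ} {m m' : ℤ} {f g : ℝ → ℝ}

theorem const (k : ℕ) (c : ℝ) : IsSmoothSymbol k 0 fun _ => c :=
  ⟨contDiffOn_const, IsSymbol.const k c⟩

theorem add (hf : IsSmoothSymbol k m f) (hg : IsSmoothSymbol k m g) :
    IsSmoothSymbol k m fun h => f h + g h :=
  ⟨hf.smooth.add hg.smooth, hf.symbol.add hg.symbol hf.smooth hg.smooth⟩

theorem mul (hf : IsSmoothSymbol k m f) (hg : IsSmoothSymbol k m' g) :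
    IsSmoothSymbol k (m + m') fun h => f h * g h :=
  ⟨hf.smooth.mul hg.smooth, hf.symbol.mul hg.symbol hf.smooth hg.smooth⟩

theorem const_mul (c : ℝ) (hf : IsSmoothSymbol k m f) : IsSmoothSymbol k m fun h => c * f h := by
  simpa using (IsSmoothSymbol.const k c).mul hf

theorem weaken (hf : IsSmoothSymbol k m f) (hm : m ≤ m') : IsSmoothSymbol k m' f :=
  ⟨hf.smooth, hf.symbol.weaken hm⟩

end IsSmoothSymbol

/-- The profile curve `χ` of a bowl soliton of speed `1` with tip at the origin, as an even function
of the signed distance to the axis: an increasing convex solution of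
`χ'' / (1 + χ'²) + (n - 1) χ' / r = 1`. -/
structure IsBowlCurve (n : ℕ) (χ : ℝ → ℝ) : Prop where
  smooth : ContDiff ℝ ∞ χ
  zero : χ 0 = 0
  deriv_zero : deriv χ 0 = 0
  deriv_pos : ∀ r > 0, 0 < deriv χ r
  deriv_deriv_nonneg : ∀ r > 0, 0 ≤ deriv (deriv χ) r
  ode : ∀ r > 0, deriv (deriv χ) r = (1 + deriv χ r ^ 2) * (1 - ((n : ℝ) - 1) * deriv χ r / r)

namespace IsBowlCurve

variable {n : ℕ} {χ χ₁ χ₂ : ℝ → ℝ}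

theorem smooth_deriv (h : IsBowlCurve n χ) : ContDiff ℝ ∞ (deriv χ) :=
  (contDiff_infty_iff_deriv.1 h.smooth).2

theorem hasDerivAt (h : IsBowlCurve n χ) (r : ℝ) : HasDerivAt χ (deriv χ r) r :=
  (contDiff_infty_iff_deriv.1 h.smooth).1.differentiableAt.hasDerivAt

theorem hasDerivAt_deriv (h : IsBowlCurve n χ) (r : ℝ) :
    HasDerivAt (deriv χ) (deriv (deriv χ) r) r :=
  (contDiff_infty_iff_deriv.1 h.smooth_deriv).1.differentiableAt.hasDerivAt

/-- Uniqueness for the singular initial value problem: the singular term `-(n-1) v / r` of the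
equation for `v = χ'` is monotone in `v`, so `(v₁ - v₂)²` grows at most exponentially, from `0`. -/
theorem deriv_unique (hn : 2 ≤ n) (h₁ : IsBowlCurve n χ₁) (h₂ : IsBowlCurve n χ₂) {r : ℝ}
    (hr : 0 ≤ r) : deriv χ₁ r = deriv χ₂ r := by
  have hn' : (2 : ℝ) ≤ n := by exact_mod_cast hn
  obtain ⟨K, hK⟩ := (isCompact_Icc (a := (0 : ℝ)) (b := r)).bddAbove_image
    ((h₁.smooth_deriv.continuous.add h₂.smooth_deriv.continuous).continuousOn)
  set g : ℝ → ℝ := fun x => Real.exp (-(2 * K) * x) * (deriv χ₁ x - deriv χ₂ x) ^ 2 with hg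
  have hgd : ∀ x, HasDerivAt g (Real.exp (-(2 * K) * x) * (-(2 * K)) *
      (deriv χ₁ x - deriv χ₂ x) ^ 2 + Real.exp (-(2 * K) * x) *
      (2 * (deriv χ₁ x - deriv χ₂ x) * (deriv (deriv χ₁) x - deriv (deriv χ₂) x))) x := by
    intro x
    refine (((hasDerivAt_id x).const_mul (-(2 * K))).exp.mul
      (((h₁.hasDerivAt_deriv x).sub (h₂.hasDerivAt_deriv x)).pow 2)).congr_deriv ?_
    simp
  have hanti : AntitoneOn g (Icc 0 r) := by
    refine antitoneOn_of_deriv_nonpos (convex_Icc 0 r)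
      (fun x _ => (hgd x).continuousAt.continuousWithinAt)
      (fun x _ => (hgd x).differentiableAt.differentiableWithinAt) fun x hx => ?_
    rw [interior_Icc] at hx
    have hx0 : 0 < x := hx.1
    have hKx : deriv χ₁ x + deriv χ₂ x ≤ K := hK ⟨x, Ioo_subset_Icc_self hx, rfl⟩
    rw [(hgd x).deriv, h₁.ode x hx0, h₂.ode x hx0]
    set a := deriv χ₁ x
    set b := deriv χ₂ x
    have ha : 0 < a := h₁.deriv_pos x hx0
    have hb : 0 < b := h₂.deriv_pos x hx0
    have e : Real.exp (-(2 * K) * x) * (-(2 * K)) * (a - b) ^ 2 + Real.exp (-(2 * K) * x) *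
        (2 * (a - b) * ((1 + a ^ 2) * (1 - ((n : ℝ) - 1) * a / x) -
          (1 + b ^ 2) * (1 - ((n : ℝ) - 1) * b / x))) =
        -(2 * Real.exp (-(2 * K) * x) * (a - b) ^ 2 *
          ((K - (a + b)) + ((n : ℝ) - 1) / x * (1 + a ^ 2 + a * b + b ^ 2))) := by
      field_simp
      ring
    rw [e, neg_nonpos]
    have : 0 ≤ ((n : ℝ) - 1) / x := div_nonneg (by linarith) hx0.le
    have : 0 ≤ K - (a + b) := by linarith
    positivity
  have h0 := hanti (left_mem_Icc.2 hr) (right_mem_Icc.2 hr) hr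
  simp only [hg, h₁.deriv_zero, h₂.deriv_zero, sub_self, ne_eq, OfNat.ofNat_ne_zero,
    not_false_eq_true, zero_pow, mul_zero] at h0
  have h1 : (deriv χ₁ r - deriv χ₂ r) ^ 2 ≤ 0 := by
    have := Real.exp_pos (-(2 * K) * r)
    exact nonpos_of_mul_nonpos_right h0 this
  have := pow_eq_zero_iff (two_ne_zero) |>.1 (le_antisymm h1 (sq_nonneg _))
  linarith

theorem unique (hn : 2 ≤ n) (h₁ : IsBowlCurve n χ₁) (h₂ : IsBowlCurve n χ₂) {r : ℝ}
    (hr : 0 ≤ r) : χ₁ r = χ₂ r := by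
  have := constant_of_has_deriv_right_zero (f := fun x => χ₁ x - χ₂ x) (a := 0) (b := r)
    (fun x _ => ((h₁.hasDerivAt x).sub (h₂.hasDerivAt x)).continuousAt.continuousWithinAt)
    (fun x hx => (((h₁.hasDerivAt x).sub (h₂.hasDerivAt x)).congr_deriv
      (by rw [deriv_unique hn h₁ h₂ hx.1, sub_self])).hasDerivWithinAt) r (right_mem_Icc.2 hr)
  simp only [h₁.zero, h₂.zero] at this
  linarith

theorem strictMonoOn (h : IsBowlCurve n χ) : StrictMonoOn χ (Ici 0) :=
  strictMonoOn_of_deriv_pos (convex_Ici 0) h.smooth.continuous.continuousOn fun x hx =>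
    h.deriv_pos x (by simpa using hx)

theorem monotone_deriv (h : IsBowlCurve n χ) :
    MonotoneOn (deriv χ) (Ici 0) :=
  monotoneOn_of_deriv_nonneg (convex_Ici 0) h.smooth_deriv.continuous.continuousOn
    (fun x _ => (h.hasDerivAt_deriv x).differentiableAt.differentiableWithinAt)
    fun x hx => h.deriv_deriv_nonneg x (by simpa using hx)

theorem convexOn (h : IsBowlCurve n χ) :
    ConvexOn ℝ (Ici 0) χ :=
  MonotoneOn.convexOn_of_deriv (convex_Ici 0) h.smooth.continuous.continuousOn
    (fun x _ => (h.hasDerivAt x).differentiableAt.differentiableWithinAt)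
    (h.monotone_deriv.mono interior_subset)

theorem deriv_mul_le (h : IsBowlCurve n χ) {r : ℝ} (hr : 0 < r) :
    ((n : ℝ) - 1) * deriv χ r ≤ r := by
  have h1 := h.deriv_deriv_nonneg r hr
  rw [h.ode r hr] at h1
  have h2 := nonneg_of_mul_nonneg_right h1 (by positivity)
  rw [sub_nonneg, div_le_one hr] at h2
  exact h2

/-- The bowl soliton lies below the paraboloid of height `r² / (2 (n - 1))`. -/
theorem le_sq (h : IsBowlCurve n χ) {r : ℝ} (hr : 0 ≤ r) :
    2 * ((n : ℝ) - 1) * χ r ≤ r ^ 2 := by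
  have hd : ∀ x, HasDerivAt (fun x => x ^ 2 - 2 * ((n : ℝ) - 1) * χ x)
      (2 * x - 2 * ((n : ℝ) - 1) * deriv χ x) x := fun x =>
    ((hasDerivAt_pow 2 x).sub ((h.hasDerivAt x).const_mul _)).congr_deriv (by simp)
  have : MonotoneOn (fun x => x ^ 2 - 2 * ((n : ℝ) - 1) * χ x) (Ici 0) := by
    refine monotoneOn_of_deriv_nonneg (convex_Ici 0)
      (fun x _ => (hd x).continuousAt.continuousWithinAt)
      (fun x _ => (hd x).differentiableAt.differentiableWithinAt) fun x hx => ?_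
    rw [interior_Ici] at hx
    rw [(hd x).deriv]
    linarith [h.deriv_mul_le hx]
  have := this self_mem_Ici hr hr
  simp only [h.zero] at this
  linarith

theorem exists_eq (h : IsBowlCurve n χ) {y : ℝ} (hy : 0 ≤ y) : ∃ r ∈ Ici (0 : ℝ), χ r = y := by
  have hv := h.deriv_pos 1 one_pos
  have hg : MonotoneOn (fun x => χ x - deriv χ 1 * x) (Ici 1) := by
    have hd : ∀ x, HasDerivAt (fun x => χ x - deriv χ 1 * x) (deriv χ x - deriv χ 1) x := fun x =>
      ((h.hasDerivAt x).sub ((hasDerivAt_id x).const_mul _)).congr_deriv (by simp)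
    refine monotoneOn_of_deriv_nonneg (convex_Ici 1)
      (fun x _ => (hd x).continuousAt.continuousWithinAt)
      (fun x _ => (hd x).differentiableAt.differentiableWithinAt) fun x hx => ?_
    rw [interior_Ici] at hx
    have hx : 1 < x := hx
    rw [(hd x).deriv, sub_nonneg]
    exact h.monotone_deriv (mem_Ici.2 zero_le_one) (mem_Ici.2 (by linarith)) hx.le
  have h1 : 0 < χ 1 := by
    have := h.strictMonoOn self_mem_Ici (mem_Ici.2 zero_le_one) one_pos
    rwa [h.zero] at this
  set r := 1 + y / deriv χ 1
  have hr : 1 ≤ r := le_add_of_nonneg_right (by positivity)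
  have h2 := hg self_mem_Ici hr hr
  have h3 : deriv χ 1 * r = deriv χ 1 + y := by simp only [r]; field_simp
  simp only [h3] at h2
  obtain ⟨x, hx, hxy⟩ := intermediate_value_Icc (by linarith : (0 : ℝ) ≤ r)
    h.smooth.continuous.continuousOn (show y ∈ Icc (χ 0) (χ r) by
      rw [h.zero]; exact ⟨hy, by linarith⟩)
  exact ⟨x, hx.1, hxy⟩

end IsBowlCurve

/-- The radius of a hypersurface of revolution with profile curve `χ`, as a function of the height:
the nonnegative solution `r` of `χ r = y`, an arbitrary value if there is none. -/
noncomputable def heightRadius (χ : ℝ → ℝ) : ℝ → ℝ := Function.invFunOn χ (Ici 0)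

namespace IsBowlCurve

variable {n : ℕ} {χ : ℝ → ℝ}

theorem apply_heightRadius (h : IsBowlCurve n χ) {y : ℝ} (hy : 0 ≤ y) :
    χ (heightRadius χ y) = y :=
  Function.invFunOn_eq (h.exists_eq hy)

theorem heightRadius_nonneg (h : IsBowlCurve n χ) {y : ℝ} (hy : 0 ≤ y) : 0 ≤ heightRadius χ y :=
  Function.invFunOn_mem (h.exists_eq hy)

theorem heightRadius_pos (h : IsBowlCurve n χ) {y : ℝ} (hy : 0 < y) : 0 < heightRadius χ y := by
  refine (h.heightRadius_nonneg hy.le).lt_of_ne fun h0 => ?_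
  have := h.apply_heightRadius hy.le
  rw [← h0, h.zero] at this
  exact hy.ne this

theorem apply_eq_iff (h : IsBowlCurve n χ) {r y : ℝ} (hr : 0 ≤ r) (hy : 0 ≤ y) :
    χ r = y ↔ r ^ 2 = heightRadius χ y ^ 2 := by
  rw [sq_eq_sq₀ hr (h.heightRadius_nonneg hy), ← h.strictMonoOn.injOn.eq_iff hr
    (h.heightRadius_nonneg hy), h.apply_heightRadius hy]

theorem hasDerivAt_heightRadius (h : IsBowlCurve n χ) {y : ℝ} (hy : 0 < y) :
    HasDerivAt (heightRadius χ) (deriv χ (heightRadius χ y))⁻¹ y := by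
  have hm : MonotoneOn (heightRadius χ) (Ioi 0) := by
    intro a ha b hb hab
    refine (h.strictMonoOn.le_iff_le (h.heightRadius_nonneg (le_of_lt ha))
      (h.heightRadius_nonneg (le_of_lt hb))).1 ?_
    rwa [h.apply_heightRadius (le_of_lt ha), h.apply_heightRadius (le_of_lt hb)]
  have hc : ContinuousAt (heightRadius χ) y := by
    refine continuousAt_of_monotoneOn_of_image_mem_nhds hm (Ioi_mem_nhds hy)
      (mem_of_superset (Ioi_mem_nhds (h.heightRadius_pos hy)) fun r hr => ?_)
    have hr : 0 < r := hr
    have h1 : 0 < χ r := by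
      have := h.strictMonoOn self_mem_Ici hr.le hr
      rwa [h.zero] at this
    exact ⟨χ r, h1, h.strictMonoOn.injOn (h.heightRadius_nonneg h1.le) hr.le
      (h.apply_heightRadius h1.le)⟩
  refine (h.hasDerivAt _).of_local_left_inverse hc (h.deriv_pos _ (h.heightRadius_pos hy)).ne' ?_
  filter_upwards [Ioi_mem_nhds hy] with x hx using h.apply_heightRadius (le_of_lt hx)

theorem contDiffOn_heightRadius (h : IsBowlCurve n χ) :
    ContDiffOn ℝ ∞ (heightRadius χ) (Ioi 0) := by
  refine contDiffOn_infty.2 fun k => ?_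
  induction k with
  | zero =>
    exact contDiffOn_zero.2 fun y hy =>
      (h.hasDerivAt_heightRadius hy).continuousAt.continuousWithinAt
  | succ k ih =>
    push_cast
    refine (contDiffOn_succ_iff_deriv_of_isOpen isOpen_Ioi).2 ⟨fun y hy =>
      (h.hasDerivAt_heightRadius hy).differentiableAt.differentiableWithinAt, by simp, ?_⟩
    refine ContDiffOn.congr (f := fun y => (deriv χ (heightRadius χ y))⁻¹) ?_
      fun y hy => (h.hasDerivAt_heightRadius hy).deriv
    exact ((h.smooth_deriv.of_le (by exact_mod_cast le_top)).comp_contDiffOn ih).inv fun y hy =>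
      (h.deriv_pos _ (h.heightRadius_pos hy)).ne'

end IsBowlCurve

/-! ### Asymptotics of the bowl soliton -/

/-- The derivative of the squared radius with respect to the height. -/
noncomputable def heightSlope (χ : ℝ → ℝ) (y : ℝ) : ℝ :=
  2 * heightRadius χ y * (deriv χ (heightRadius χ y))⁻¹

/-- The deviation of the squared radius at height `y` from `2 (n - 1) y`, its value for a cylinder
shrinking by mean curvature. -/
noncomputable def heightError (n : ℕ) (χ : ℝ → ℝ) (y : ℝ) : ℝ :=
  heightRadius χ y ^ 2 - 2 * ((n : ℝ) - 1) * y

/-- The derivative of `heightError`. -/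
noncomputable def slopeError (n : ℕ) (χ : ℝ → ℝ) (y : ℝ) : ℝ :=
  heightSlope χ y - 2 * ((n : ℝ) - 1)

namespace IsBowlCurve

variable {n : ℕ} {χ : ℝ → ℝ}

theorem hasDerivAt_heightRadius_sq (h : IsBowlCurve n χ) {y : ℝ} (hy : 0 < y) :
    HasDerivAt (fun y => heightRadius χ y ^ 2) (heightSlope χ y) y :=
  ((h.hasDerivAt_heightRadius hy).pow 2).congr_deriv (by simp [heightSlope])

theorem hasDerivAt_inv_heightRadius_sq (h : IsBowlCurve n χ) {y : ℝ} (hy : 0 < y) :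
    HasDerivAt (fun y => (heightRadius χ y ^ 2)⁻¹)
      (-(heightSlope χ y * ((heightRadius χ y ^ 2)⁻¹) ^ 2)) y := by
  have hR := h.heightRadius_pos hy
  exact ((h.hasDerivAt_heightRadius_sq hy).inv (by positivity)).congr_deriv (by field_simp)

theorem contDiffOn_heightSlope (h : IsBowlCurve n χ) : ContDiffOn ℝ ∞ (heightSlope χ) (Ioi 0) :=
  (contDiffOn_const.mul h.contDiffOn_heightRadius).mul
    ((h.smooth_deriv.comp_contDiffOn h.contDiffOn_heightRadius).inv fun _ hy =>
      (h.deriv_pos _ (h.heightRadius_pos hy)).ne')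

theorem contDiffOn_slopeError (h : IsBowlCurve n χ) :
    ContDiffOn ℝ ∞ (slopeError n χ) (Ioi 0) :=
  h.contDiffOn_heightSlope.sub contDiffOn_const

theorem contDiffOn_heightError (h : IsBowlCurve n χ) :
    ContDiffOn ℝ ∞ (heightError n χ) (Ioi 0) :=
  (h.contDiffOn_heightRadius.pow 2).sub (contDiffOn_const.mul contDiffOn_id)

theorem hasDerivAt_heightError (h : IsBowlCurve n χ) {y : ℝ} (hy : 0 < y) :
    HasDerivAt (heightError n χ) (slopeError n χ y) y :=
  ((h.hasDerivAt_heightRadius_sq hy).sub ((hasDerivAt_id y).const_mul _)).congr_deriv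
    (by simp [slopeError])

theorem slopeError_nonneg (h : IsBowlCurve n χ) {y : ℝ} (hy : 0 < y) : 0 ≤ slopeError n χ y := by
  have h1 := h.deriv_mul_le (h.heightRadius_pos hy)
  have h2 := h.deriv_pos _ (h.heightRadius_pos hy)
  rw [slopeError, heightSlope, ← div_eq_mul_inv, sub_nonneg, le_div_iff₀ h2]
  linarith

theorem le_heightRadius_sq (h : IsBowlCurve n χ) {y : ℝ} (hy : 0 < y) :
    2 * ((n : ℝ) - 1) * y ≤ heightRadius χ y ^ 2 := by
  simpa [h.apply_heightRadius hy.le] using h.le_sq (h.heightRadius_pos hy).le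

/-- The equation of the bowl soliton in terms of the squared radius `F` as a function of the height:
with `W = F'` and `D = W - 2 (n - 1)` it reads `D' = -(1 + W² / (4 F)) D + W² / (2 F)`. -/
theorem hasDerivAt_slopeError (h : IsBowlCurve n χ) {y : ℝ} (hy : 0 < y) :
    HasDerivAt (slopeError n χ)
      (-((1 + heightSlope χ y ^ 2 * (heightRadius χ y ^ 2)⁻¹ / 4) * slopeError n χ y) +
        heightSlope χ y ^ 2 * (heightRadius χ y ^ 2)⁻¹ / 2) y := by
  have hR := h.heightRadius_pos hy
  have hv := h.deriv_pos _ hR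
  have d1 := h.hasDerivAt_heightRadius hy
  have d2 := (h.hasDerivAt_deriv (heightRadius χ y)).comp y d1
  refine (((d1.const_mul 2).mul (d2.inv hv.ne')).sub_const (2 * ((n : ℝ) - 1))).congr_deriv ?_
  simp only [Function.comp_apply, Pi.inv_apply, slopeError, heightSlope]
  rw [h.ode _ hR]
  field_simp
  ring

/-- The factor `1 + W² / (4 F)` damps `D`, and the source `W² / (2 F)` is at most twice the
factor. -/
theorem slopeError_bounded (h : IsBowlCurve n χ) : ∃ M, ∀ y ≥ 1, |slopeError n χ y| ≤ M := by
  refine ⟨max |slopeError n χ 1| 2, abs_le_of_deriv_eq_damped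
    (fun y hy => h.hasDerivAt_slopeError (by linarith)) (fun y _ => by positivity)
    (fun y _ => ?_) (le_max_left _ _)⟩
  have h0 : 0 ≤ heightSlope χ y ^ 2 * (heightRadius χ y ^ 2)⁻¹ := by positivity
  rw [abs_of_nonneg (by positivity)]
  have := le_max_right |slopeError n χ 1| 2
  nlinarith

theorem inv_heightRadius_sq_isBigO (hn : 2 ≤ n) (h : IsBowlCurve n χ) :
    (fun y => (heightRadius χ y ^ 2)⁻¹) =O[atTop] fun y : ℝ => y ^ (-1 : ℤ) := by
  have hn' : (2 : ℝ) ≤ n := by exact_mod_cast hn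
  refine IsBigO.of_bound 1 ?_
  filter_upwards [eventually_gt_atTop 0] with y hy
  have h1 := h.le_heightRadius_sq hy
  rw [Real.norm_of_nonneg (by positivity), Real.norm_of_nonneg (by positivity), one_mul, zpow_neg_one]
  exact inv_anti₀ hy (by nlinarith)

theorem slopeError_isBigO_one (h : IsBowlCurve n χ) :
    slopeError n χ =O[atTop] fun y : ℝ => y ^ (0 : ℤ) := by
  obtain ⟨M, hM⟩ := h.slopeError_bounded
  refine IsBigO.of_bound M ?_
  filter_upwards [eventually_ge_atTop 1] with y hy
  simpa using hM y hy

theorem isSymbol_heightSlope {k : ℕ}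
    (hD : IsSmoothSymbol k 0 (slopeError n χ)) : IsSmoothSymbol k 0 (heightSlope χ) := by
  have := hD.add (IsSmoothSymbol.const k (2 * ((n : ℝ) - 1)))
  simpa [slopeError] using this

theorem isSymbol_inv_sq {k : ℕ} (hn : 2 ≤ n) (h : IsBowlCurve n χ)
    (hW : IsSmoothSymbol k 0 (heightSlope χ)) :
    IsSmoothSymbol k (-1) fun y => (heightRadius χ y ^ 2)⁻¹ := by
  have hs : ContDiffOn ℝ ∞ (fun y => (heightRadius χ y ^ 2)⁻¹) (Ioi 0) :=
    (h.contDiffOn_heightRadius.pow 2).inv fun y hy => by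
      have := h.heightRadius_pos hy
      positivity
  refine ⟨hs, ?_⟩
  induction k with
  | zero => exact h.inv_heightRadius_sq_isBigO hn
  | succ k ih =>
    have hW' : IsSmoothSymbol k 0 (heightSlope χ) := ⟨hW.smooth, hW.symbol.pred⟩
    have hE : IsSmoothSymbol k (-1) fun y => (heightRadius χ y ^ 2)⁻¹ := ⟨hs, ih hW'⟩
    refine ⟨h.inv_heightRadius_sq_isBigO hn, ?_⟩
    refine (((hW'.mul hE).mul hE).const_mul (-1)).symbol.congr fun y hy => ?_
    rw [(h.hasDerivAt_inv_heightRadius_sq hy).deriv]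
    ring

/-- The error `D` in the slope satisfies `D^{(j)} = O(y^{-1-j})` for all `j`. To gain one derivative,
`D'` is regarded as a solution of the differentiated equation, which is again damped, and whose
other coefficients involve `D` and `1 / F` only. -/
theorem isSymbol_slopeError (hn : 2 ≤ n) (h : IsBowlCurve n χ) (k : ℕ) :
    IsSmoothSymbol k (-1) (slopeError n χ) := by
  refine ⟨h.contDiffOn_slopeError, ?_⟩
  have base : slopeError n χ =O[atTop] fun y : ℝ => y ^ (-1 : ℤ) := by
    have hD : IsSmoothSymbol 0 0 (slopeError n χ) :=
      ⟨h.contDiffOn_slopeError, h.slopeError_isBigO_one⟩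
    have hW := isSymbol_heightSlope hD
    have hE := h.isSymbol_inv_sq hn hW
    have hb := (((hW.mul hW).mul hE).const_mul (1 / 2)).symbol
    refine isBigO_zpow_of_damped ((eventually_gt_atTop 0).mono fun y hy =>
      h.hasDerivAt_slopeError hy) (Eventually.of_forall fun y => ?_) ?_
    · have : 0 ≤ heightSlope χ y ^ 2 * (heightRadius χ y ^ 2)⁻¹ / 4 := by positivity
      linarith
    · have e : (fun y => heightSlope χ y ^ 2 * (heightRadius χ y ^ 2)⁻¹ / 2) = fun y =>
          1 / 2 * (heightSlope χ y * heightSlope χ y * (heightRadius χ y ^ 2)⁻¹) := by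
        funext y; ring
      rw [e]
      exact hb.isBigO
  induction k with
  | zero => exact base
  | succ k ih =>
    refine ⟨base, ?_⟩
    have hD : IsSmoothSymbol k (-1) (slopeError n χ) := ⟨h.contDiffOn_slopeError, ih⟩
    have hW := isSymbol_heightSlope (hD.weaken (by norm_num))
    have hE := h.isSymbol_inv_sq hn hW
    have hWE := hW.mul hE
    have hWWE := hW.mul hWE
    have hWED := hWE.mul hD
    set D := slopeError n χ with hDdef
    set W := heightSlope χ with hWdef
    set E := fun y => (heightRadius χ y ^ 2)⁻¹ with hEdef
    have hA : IsSmoothSymbol k 0 fun y => 1 + ((1 / 4) * (W y * (W y * E y)) +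
        ((1 / 2) * (W y * E y * D y) + (-1) * (W y * E y))) :=
      (IsSmoothSymbol.const k 1).add (((hWWE.const_mul (1 / 4)).weaken (by norm_num)).add
        (((hWED.const_mul (1 / 2)).weaken (by norm_num)).add
          ((hWE.const_mul (-1)).weaken (by norm_num))))
    have hb : IsSmoothSymbol k (-1 - 1) fun y =>
        (1 / 4) * (W y * (W y * E y) * (W y * E y * D y)) +
          (-(1 / 2)) * (W y * (W y * E y) * (W y * E y)) :=
      (((hWWE.mul hWED).const_mul (1 / 4)).weaken (by norm_num)).add
        (((hWWE.mul hWE).const_mul (-(1 / 2))).weaken (by norm_num))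
    have dD : ∀ y > 0, HasDerivAt D (-((1 + W y ^ 2 * E y / 4) * D y) + W y ^ 2 * E y / 2) y :=
      fun y hy => h.hasDerivAt_slopeError hy
    have sD := (contDiffOn_infty_iff_deriv_of_isOpen isOpen_Ioi).1 hD.smooth
    refine IsSymbol.of_damped ?_ sD.2 hA.smooth hb.smooth ?_ hA.symbol hb.symbol
    · intro y hy
      have dE : HasDerivAt E (-(W y * E y ^ 2)) y := h.hasDerivAt_inv_heightRadius_sq hy
      have d1 : HasDerivAt D (deriv D y) y := (sD.1.differentiableAt (Ioi_mem_nhds hy)).hasDerivAt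
      have d2 : HasDerivAt W (deriv D y) y := by
        have := d1.add_const (2 * ((n : ℝ) - 1))
        simpa [hDdef, slopeError] using this
      have e : deriv D =ᶠ[𝓝 y] fun y => -((1 + W y ^ 2 * E y / 4) * D y) + W y ^ 2 * E y / 2 :=
        Filter.eventually_of_mem (Ioi_mem_nhds hy) fun x hx => (dD x hx).deriv
      have d3 := (d2.pow 2).mul dE
      refine HasDerivAt.congr_of_eventuallyEq ?_ e
      refine ((((d3.div_const 4).const_add 1).mul d1).neg.add (d3.div_const 2)).congr_deriv ?_
      simp only [Pi.pow_apply, Pi.mul_apply, Nat.cast_ofNat, Nat.add_one_sub_one, pow_one]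
      ring
    · have t0 : Tendsto (fun y => W y * E y) atTop (𝓝 0) := by
        refine hWE.symbol.isBigO.trans_tendsto ?_
        simpa using tendsto_inv_atTop_zero (𝕜 := ℝ)
      filter_upwards [t0.eventually_lt_const (show (0 : ℝ) < 1 / 2 by norm_num),
        eventually_gt_atTop 0] with y hy hy0
      have hR := h.heightRadius_pos hy0
      have hE0 : 0 ≤ E y := by positivity
      have hD0 : 0 ≤ D y := h.slopeError_nonneg hy0
      have hW0 : 0 ≤ W y := by
        have := h.deriv_pos _ hR
        simp only [hWdef, heightSlope]
        positivity
      have : 0 ≤ W y * (W y * E y) := by positivity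
      have : 0 ≤ W y * E y * D y := by positivity
      linarith

theorem heightError_isLittleO (hn : 2 ≤ n) (h : IsBowlCurve n χ) :
    heightError n χ =o[atTop] fun y : ℝ => y := by
  obtain ⟨B, hB0, hB⟩ := (h.isSymbol_slopeError hn 0).symbol.isBigO.exists_pos
  obtain ⟨a, ha⟩ := eventually_atTop.1 (hB.bound.and (eventually_gt_atTop (0 : ℝ)))
  have hanti : AntitoneOn (fun y => heightError n χ y - B * Real.log y) (Ici a) := by
    have hd : ∀ y ≥ a, HasDerivAt (fun y => heightError n χ y - B * Real.log y)
        (slopeError n χ y - B * y⁻¹) y := fun y hy =>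
      (h.hasDerivAt_heightError (ha y hy).2).sub
        ((Real.hasDerivAt_log (ha y hy).2.ne').const_mul B)
    refine antitoneOn_of_deriv_nonpos (convex_Ici a)
      (fun y hy => (hd y hy).continuousAt.continuousWithinAt)
      (fun y hy => (hd y (interior_subset hy)).differentiableAt.differentiableWithinAt)
      fun y hy => ?_
    have hy' : a ≤ y := interior_subset hy
    have h1 := (ha y hy').1
    rw [Real.norm_of_nonneg (h.slopeError_nonneg (ha y hy').2), zpow_neg_one,
      Real.norm_of_nonneg (inv_nonneg.2 (ha y hy').2.le)] at h1
    rw [(hd y hy').deriv]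
    linarith
  have hO : heightError n χ =O[atTop]
      fun y : ℝ => ‖heightError n χ a - B * Real.log a‖ + ‖B * Real.log y‖ := by
    refine IsBigO.of_bound 1 ?_
    filter_upwards [eventually_ge_atTop a] with y hy
    have h1 := hanti self_mem_Ici hy hy
    have h2 := h.le_heightRadius_sq (ha y hy).2
    have h3 : 0 ≤ heightError n χ y := by rw [heightError]; linarith
    rw [Real.norm_of_nonneg h3, Real.norm_of_nonneg (by positivity), one_mul]
    have h4 := le_abs_self (heightError n χ a - B * Real.log a)
    have h5 := le_abs_self (B * Real.log y)
    simp only [Real.norm_eq_abs] at *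
    linarith
  refine hO.trans_isLittleO (IsLittleO.add ?_ ?_)
  · exact isLittleO_const_left.2 (Or.inr tendsto_norm_atTop_atTop)
  · exact (Real.isLittleO_log_id_atTop.const_mul_left B).norm_left

/-- `heightError` is `o(y)` and so are its derivatives after multiplication by `y^j`. -/
theorem tendsto_iteratedDeriv_heightError (hn : 2 ≤ n) (h : IsBowlCurve n χ) (j : ℕ) :
    Tendsto (fun y => iteratedDeriv j (heightError n χ) y * y ^ j / y) atTop (𝓝 0) := by
  cases j with
  | zero => simpa using (h.heightError_isLittleO hn).tendsto_div_nhds_zero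
  | succ i =>
    have h1 := (h.isSymbol_slopeError hn i).symbol.iteratedDeriv_isBigO
    have h2 : (fun y => iteratedDeriv (i + 1) (heightError n χ) y * y ^ (i + 1) / y) =O[atTop]
        fun y : ℝ => y ^ (-1 : ℤ) := by
      refine (h1.mul (isBigO_refl (fun y : ℝ => y ^ i) atTop)).congr' ?_ ?_
      · filter_upwards [eventually_gt_atTop 0] with y hy
        have e : deriv (heightError n χ) =ᶠ[𝓝 y] slopeError n χ :=
          Filter.eventually_of_mem (Ioi_mem_nhds hy) fun x hx => (h.hasDerivAt_heightError hx).deriv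
        rw [iteratedDeriv_succ', e.iteratedDeriv_eq, pow_succ]
        field_simp
      · filter_upwards [eventually_gt_atTop 0] with y hy
        rw [← zpow_natCast, ← zpow_add₀ hy.ne', sub_add_cancel]
    refine h2.trans_tendsto ?_
    simpa using tendsto_inv_atTop_zero (𝕜 := ℝ)

end IsBowlCurve

theorem iteratedDeriv_comp_mul_left' (f : ℝ → ℝ) (a : ℝ) (j : ℕ) :
    iteratedDeriv j (fun t => f (a * t)) = fun t => a ^ j * iteratedDeriv j f (a * t) := by
  induction j with
  | zero => simp
  | succ j ih =>
    funext t
    rw [iteratedDeriv_succ, ih, deriv_const_mul_field, deriv_comp_mul_left, iteratedDeriv_succ,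
      smul_eq_mul, pow_succ, mul_assoc]

/-- The rescaled error `τ ↦ μ² · err(τ / μ²)` tends to zero as `μ → 0` with all derivatives, uniformly
on compact subsets of `(0, ∞)`. -/
theorem IsBowlCurve.rescaled_heightError_small {n : ℕ} {χ : ℝ → ℝ} (hn : 2 ≤ n)
    (h : IsBowlCurve n χ) (j : ℕ) {lo hi : ℝ} (hlo : 0 < lo) {η : ℝ} (hη : 0 < η) :
    ∀ᶠ μ in 𝓝[>] (0 : ℝ), ∀ τ ∈ Icc lo hi,
      |iteratedDeriv j (fun τ => μ ^ 2 * heightError n χ ((μ ^ 2)⁻¹ * τ)) τ| ≤ η := by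
  set η' := η / (|hi| * (lo ^ j)⁻¹ + 1) with hη'
  have hη'0 : 0 < η' := by positivity
  obtain ⟨a, ha⟩ := eventually_atTop.1 ((Metric.tendsto_nhds.1
    (h.tendsto_iteratedDeriv_heightError hn j)) η' hη'0)
  have t : Tendsto (fun μ : ℝ => (μ ^ 2)⁻¹ * lo) (𝓝[>] 0) atTop := by
    refine Tendsto.atTop_mul_const hlo (tendsto_inv_nhdsGT_zero.comp ?_)
    refine tendsto_nhdsWithin_iff.2 ⟨?_, ?_⟩
    · have : Tendsto (fun μ : ℝ => μ ^ 2) (𝓝 0) (𝓝 (0 ^ 2)) := (continuous_pow 2).tendsto 0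
      simpa using this.mono_left nhdsWithin_le_nhds
    · filter_upwards [self_mem_nhdsWithin] with μ hμ
      have hμ : 0 < μ := hμ
      exact pow_pos hμ 2
  filter_upwards [t.eventually_ge_atTop a, self_mem_nhdsWithin] with μ h1 hμ τ hτ
  have hμ : 0 < μ := hμ
  have hτ0 : 0 < τ := hlo.trans_le hτ.1
  have hb : 0 < (μ ^ 2)⁻¹ := by positivity
  rw [iteratedDeriv_const_mul_field, iteratedDeriv_comp_mul_left']
  have h2 := ha ((μ ^ 2)⁻¹ * τ) (h1.trans (by gcongr; exact hτ.1))
  rw [dist_zero_right, Real.norm_eq_abs] at h2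
  set x := iteratedDeriv j (heightError n χ) ((μ ^ 2)⁻¹ * τ)
  have e : μ ^ 2 * (((μ ^ 2)⁻¹) ^ j * x) =
      (x * ((μ ^ 2)⁻¹ * τ) ^ j / ((μ ^ 2)⁻¹ * τ)) * (τ * (τ ^ j)⁻¹) := by
    rw [mul_pow]
    field_simp
  rw [e, abs_mul, abs_of_pos (show 0 < τ * (τ ^ j)⁻¹ by positivity)]
  have h3 : τ * (τ ^ j)⁻¹ ≤ |hi| * (lo ^ j)⁻¹ := by
    have := hτ.1
    have := hτ.2.trans (le_abs_self hi)
    gcongr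
  calc _ ≤ η' * (|hi| * (lo ^ j)⁻¹) := by gcongr
    _ ≤ η' * (|hi| * (lo ^ j)⁻¹ + 1) := by gcongr; linarith
    _ = η := by rw [hη']; field_simp

/-! ### Families of functions that are bounded, or tend to zero, with their derivatives -/

section CkBounds

variable {E : Type*} [NormedAddCommGroup E] [NormedSpace ℝ E]

/-- At every point of `S` the function `f` is `C^k` with all derivatives up to order `k` bounded
by `B`. -/
def HasCkBound (k : ℕ) (S : Set E) (B : ℝ) (f : E → ℝ) : Prop :=
  ∀ x ∈ S, ContDiffAt ℝ k f x ∧ ∀ j ≤ k, ‖iteratedFDeriv ℝ j f x‖ ≤ B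

namespace HasCkBound

variable {k : ℕ} {S : Set E} {B B' : ℝ} {f g : E → ℝ}

theorem mono (hf : HasCkBound k S B f) (h : B ≤ B') : HasCkBound k S B' f := fun x hx =>
  ⟨(hf x hx).1, fun j hj => ((hf x hx).2 j hj).trans h⟩

theorem abs_le (hf : HasCkBound k S B f) {x : E} (hx : x ∈ S) : |f x| ≤ B := by
  simpa using (hf x hx).2 0 (Nat.zero_le k)

theorem add (hf : HasCkBound k S B f) (hg : HasCkBound k S B' g) :
    HasCkBound k S (B + B') fun x => f x + g x := fun x hx =>
  ⟨(hf x hx).1.add (hg x hx).1, fun j hj => by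
    have hjk : (j : ℕ∞ω) ≤ k := by exact_mod_cast hj
    rw [fun_iteratedFDeriv_add_apply ((hf x hx).1.of_le hjk) ((hg x hx).1.of_le hjk)]
    exact (norm_add_le _ _).trans (add_le_add ((hf x hx).2 j hj) ((hg x hx).2 j hj))⟩

theorem congr (hf : HasCkBound k S B f) (h : ∀ x ∈ S, g =ᶠ[𝓝 x] f) : HasCkBound k S B g :=
  fun x hx => ⟨(hf x hx).1.congr_of_eventuallyEq (h x hx), fun j hj => by
    rw [((h x hx).iteratedFDeriv ℝ j).eq_of_nhds]
    exact (hf x hx).2 j hj⟩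

theorem const (c : ℝ) : HasCkBound k S |c| fun _ : E => c := fun x _ =>
  ⟨contDiffAt_const, fun j _ => by
    cases j with
    | zero => simp
    | succ j => simp [iteratedFDeriv_const_of_ne (Nat.succ_ne_zero j)]⟩

theorem clm (L : E →L[ℝ] ℝ) {R : ℝ} (hR : 1 ≤ R) (hL : ‖L‖ ≤ B)
    (hS : ∀ x ∈ S, ‖x‖ ≤ R) : HasCkBound k S (B * R) fun x => L x := fun x hx =>
  ⟨L.contDiff.contDiffAt, fun j _ => by
    have hB : 0 ≤ B := (norm_nonneg L).trans hL
    rcases j with _ | _ | j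
    · rw [norm_iteratedFDeriv_zero]
      exact (L.le_opNorm x).trans (mul_le_mul hL (hS x hx) (norm_nonneg _) hB)
    · rw [← norm_iteratedFDeriv_fderiv, norm_iteratedFDeriv_zero, L.fderiv]
      nlinarith
    · rw [← norm_iteratedFDeriv_fderiv]
      have : fderiv ℝ (fun x => L x) = fun _ => L := funext fun x => L.fderiv
      rw [this, iteratedFDeriv_const_of_ne (Nat.succ_ne_zero j)]
      simp only [Pi.zero_apply, norm_zero]
      positivity⟩

theorem mul (hf : HasCkBound k S B f) (hg : HasCkBound k S B' g) :
    HasCkBound k S (2 ^ k * B * B') fun x => f x * g x := fun x hx =>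
  ⟨(hf x hx).1.mul (hg x hx).1, fun j hj => by
    have hjk : (j : ℕ∞ω) ≤ k := by exact_mod_cast hj
    have hB : 0 ≤ B := (abs_nonneg _).trans (hf.abs_le hx)
    have hB' : 0 ≤ B' := (abs_nonneg _).trans (hg.abs_le hx)
    obtain ⟨u, hu, hfu⟩ := (hf x hx).1.contDiffOn le_rfl (by simp)
    obtain ⟨v, hv, hgv⟩ := (hg x hx).1.contDiffOn le_rfl (by simp)
    obtain ⟨o, ho, hoo, hxo⟩ := mem_nhds_iff.1 (inter_mem hu hv)
    have key := norm_iteratedFDerivWithin_mul_le (hfu.mono (ho.trans inter_subset_left))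
      (hgv.mono (ho.trans inter_subset_right)) hoo.uniqueDiffOn hxo hjk
    simp only [iteratedFDerivWithin_of_isOpen _ hoo hxo] at key
    refine key.trans ?_
    calc _ ≤ ∑ i ∈ Finset.range (j + 1), (j.choose i : ℝ) * B * B' := by
          refine Finset.sum_le_sum fun i hi => ?_
          have hi : i < j + 1 := Finset.mem_range.1 hi
          have h1 := (hf x hx).2 i (by lia)
          have h2 := (hg x hx).2 (j - i) (by lia)
          gcongr
      _ = 2 ^ j * B * B' := by
          rw [← Finset.sum_mul, ← Finset.sum_mul]
          congr 2
          exact_mod_cast Nat.sum_range_choose j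
      _ ≤ 2 ^ k * B * B' := by
          gcongr
          norm_num⟩

theorem comp {φ : ℝ → ℝ} {C : ℝ} (hf : HasCkBound k S B f)
    (hφ : ∀ x ∈ S, ContDiffAt ℝ k φ (f x) ∧ ∀ j ≤ k, |iteratedDeriv j φ (f x)| ≤ C) :
    HasCkBound k S (k.factorial * C * max 1 B ^ k) fun x => φ (f x) := fun x hx =>
  ⟨(hφ x hx).1.comp x (hf x hx).1, fun j hj => by
    have hjk : (j : ℕ∞ω) ≤ k := by exact_mod_cast hj
    have hC : 0 ≤ C := (abs_nonneg _).trans ((hφ x hx).2 0 (Nat.zero_le k))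
    obtain ⟨u, hu, hfu⟩ := (hf x hx).1.contDiffOn le_rfl (by simp)
    obtain ⟨v, hv, hgv⟩ := (hφ x hx).1.contDiffOn le_rfl (by simp)
    obtain ⟨o', ho', hoo', hxo'⟩ := mem_nhds_iff.1 hv
    obtain ⟨o, ho, hoo, hxo⟩ := mem_nhds_iff.1
      (inter_mem hu ((hf x hx).1.continuousAt.preimage_mem_nhds (hoo'.mem_nhds hxo')))
    have key := norm_iteratedFDerivWithin_comp_le (n := j) (C := C) (D := max 1 B)
      (hgv.mono ho') (hfu.mono (ho.trans inter_subset_left)) hjk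
      hoo'.uniqueDiffOn hoo.uniqueDiffOn (fun y hy => (ho hy).2) hxo
      (fun i hi => by
        rw [iteratedFDerivWithin_of_isOpen _ hoo' hxo', norm_iteratedFDeriv_eq_norm_iteratedDeriv]
        exact (hφ x hx).2 i (hi.trans hj))
      (fun i h1 hi => by
        rw [iteratedFDerivWithin_of_isOpen _ hoo hxo]
        exact ((hf x hx).2 i (hi.trans hj)).trans ((le_max_right 1 B).trans
          (le_self_pow₀ (le_max_left 1 B) (by lia))))
    rw [iteratedFDerivWithin_of_isOpen _ hoo hxo] at key
    refine key.trans ?_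
    have : 1 ≤ max 1 B := le_max_left 1 B
    gcongr⟩

end HasCkBound

variable {ι : Type*}

/-- The functions `f i` are bounded in `C^k` on the sets `S i`, uniformly for `i` close to `l`. -/
def IsCkBounded (l : Filter ι) (k : ℕ) (S : ι → Set E) (f : ι → E → ℝ) : Prop :=
  ∃ B, ∀ᶠ i in l, HasCkBound k (S i) B (f i)

/-- The functions `f i` tend to zero in `C^k` on the sets `S i` along the filter `l`. -/
def IsCkNull (l : Filter ι) (k : ℕ) (S : ι → Set E) (f : ι → E → ℝ) : Prop :=
  ∀ η > 0, ∀ᶠ i in l, HasCkBound k (S i) η (f i)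

variable {l : Filter ι} {k : ℕ} {S : ι → Set E} {f g : ι → E → ℝ}

theorem IsCkNull.isCkBounded (hf : IsCkNull l k S f) : IsCkBounded l k S f :=
  ⟨1, hf 1 one_pos⟩

theorem IsCkBounded.add (hf : IsCkBounded l k S f) (hg : IsCkBounded l k S g) :
    IsCkBounded l k S fun i x => f i x + g i x := by
  obtain ⟨B, hB⟩ := hf
  obtain ⟨B', hB'⟩ := hg
  exact ⟨B + B', by filter_upwards [hB, hB'] with i h h' using h.add h'⟩

theorem IsCkBounded.mul (hf : IsCkBounded l k S f) (hg : IsCkBounded l k S g) :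
    IsCkBounded l k S fun i x => f i x * g i x := by
  obtain ⟨B, hB⟩ := hf
  obtain ⟨B', hB'⟩ := hg
  exact ⟨2 ^ k * B * B', by filter_upwards [hB, hB'] with i h h' using h.mul h'⟩

theorem IsCkBounded.const (c : ℝ) : IsCkBounded l k S fun _ _ => c :=
  ⟨|c|, Eventually.of_forall fun _ => HasCkBound.const c⟩

theorem IsCkNull.add (hf : IsCkNull l k S f) (hg : IsCkNull l k S g) :
    IsCkNull l k S fun i x => f i x + g i x := fun η hη => by
  filter_upwards [hf (η / 2) (half_pos hη), hg (η / 2) (half_pos hη)] with i h h'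
  exact (h.add h').mono (by linarith)

theorem IsCkNull.mul (hf : IsCkNull l k S f) (hg : IsCkBounded l k S g) :
    IsCkNull l k S fun i x => f i x * g i x := fun η hη => by
  obtain ⟨B, hB⟩ := hg
  filter_upwards [hf (η / (2 ^ k * (|B| + 1))) (by positivity), hB] with i h h'
  refine (h.mul (h'.mono ((le_abs_self B).trans (le_add_of_nonneg_right zero_le_one)))).mono
    (le_of_eq ?_)
  field_simp

theorem IsCkNull.of_tendsto {c : ι → ℝ} (hc : Tendsto c l (𝓝 0)) :
    IsCkNull l k S fun i _ => c i := fun η hη => by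
  filter_upwards [Metric.tendsto_nhds.1 hc η hη] with i hi
  refine (HasCkBound.const (c i)).mono ?_
  simpa using hi.le

theorem IsCkNull.congr (hf : IsCkNull l k S f) (h : ∀ᶠ i in l, ∀ x ∈ S i, g i =ᶠ[𝓝 x] f i) :
    IsCkNull l k S g := fun η hη => by
  filter_upwards [hf η hη, h] with i h1 h2 using h1.congr h2

theorem IsCkBounded.congr (hf : IsCkBounded l k S f) (h : ∀ᶠ i in l, ∀ x ∈ S i, g i =ᶠ[𝓝 x] f i) :
    IsCkBounded l k S g := by
  obtain ⟨B, hB⟩ := hf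
  exact ⟨B, by filter_upwards [hB, h] with i h1 h2 using h1.congr h2⟩

theorem IsCkBounded.clm {L : ι → E →L[ℝ] ℝ} {B R : ℝ} (hL : ∀ᶠ i in l, ‖L i‖ ≤ B)
    (hS : ∀ᶠ i in l, ∀ x ∈ S i, ‖x‖ ≤ R) : IsCkBounded l k S fun i x => L i x := by
  refine ⟨B * max 1 R, ?_⟩
  filter_upwards [hL, hS] with i h1 h2
  exact HasCkBound.clm (L i) (le_max_left 1 R) h1 fun x hx => (h2 x hx).trans (le_max_right 1 R)

theorem IsCkNull.clm {L : ι → E →L[ℝ] ℝ} {R : ℝ} (hL : Tendsto (fun i => ‖L i‖) l (𝓝 0))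
    (hS : ∀ᶠ i in l, ∀ x ∈ S i, ‖x‖ ≤ R) : IsCkNull l k S fun i x => L i x := fun η hη => by
  have hR : 0 < max 1 R := lt_max_of_lt_left one_pos
  filter_upwards [hL.eventually_lt_const (div_pos hη hR), hS] with i h1 h2
  refine (HasCkBound.clm (L i) (le_max_left 1 R) h1.le fun x hx =>
    (h2 x hx).trans (le_max_right 1 R)).mono (le_of_eq ?_)
  field_simp

theorem IsCkBounded.of_contDiff [FiniteDimensional ℝ E] {F : E → ℝ} {R : ℝ}
    (hF : ContDiff ℝ ∞ F) (hS : ∀ᶠ i in l, ∀ x ∈ S i, ‖x‖ ≤ R) :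
    IsCkBounded l k S fun _ => F := by
  have hF' : ContDiff ℝ k F := hF.of_le (by exact_mod_cast le_top)
  have h : ∀ j : ℕ, ∃ B, j ≤ k → ∀ x ∈ Metric.closedBall (0 : E) R, ‖iteratedFDeriv ℝ j F x‖ ≤ B := by
    intro j
    by_cases hj : j ≤ k
    · obtain ⟨B, hB⟩ := (isCompact_closedBall (0 : E) R).exists_bound_of_continuousOn
        (hF'.continuous_iteratedFDeriv (by exact_mod_cast hj)).continuousOn
      exact ⟨B, fun _ => hB⟩
    · exact ⟨0, fun h => (hj h).elim⟩
  choose B hB using h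
  refine ⟨∑ j ∈ Finset.range (k + 1), |B j|, ?_⟩
  filter_upwards [hS] with i hi x hx
  refine ⟨hF'.contDiffAt, fun j hj => ?_⟩
  refine ((hB j hj x (by simpa using hi x hx)).trans (le_abs_self _)).trans ?_
  exact Finset.single_le_sum (f := fun j => |B j|) (fun _ _ => abs_nonneg _)
    (Finset.mem_range.2 (by lia))

theorem IsCkNull.comp {φ : ι → ℝ → ℝ} {lo hi : ℝ} (hf : IsCkBounded l k S f)
    (hφ : ∀ η > 0, ∀ᶠ i in l, ∀ t ∈ Icc lo hi, ContDiffAt ℝ k (φ i) t ∧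
      ∀ j ≤ k, |iteratedDeriv j (φ i) t| ≤ η)
    (hS : ∀ᶠ i in l, ∀ x ∈ S i, f i x ∈ Icc lo hi) : IsCkNull l k S fun i x => φ i (f i x) := by
  intro η hη
  obtain ⟨B, hB⟩ := hf
  have h0 : 0 < k.factorial * max 1 B ^ k := by positivity
  filter_upwards [hB, hS, hφ (η / (k.factorial * max 1 B ^ k)) (div_pos hη h0)] with i h1 h2 h3
  refine (h1.comp fun x hx => h3 _ (h2 x hx)).mono (le_of_eq ?_)
  field_simp

theorem IsCkBounded.comp {φ : ℝ → ℝ} {lo hi : ℝ} (hf : IsCkBounded l k S f)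
    (hφ : ContDiffOn ℝ ∞ φ (Ioi 0)) (hlo : 0 < lo)
    (hS : ∀ᶠ i in l, ∀ x ∈ S i, f i x ∈ Icc lo hi) : IsCkBounded l k S fun i x => φ (f i x) := by
  obtain ⟨B, hB⟩ := hf
  have hφ' : ∀ t ∈ Icc lo hi, ContDiffAt ℝ k φ t := fun t ht =>
    (hφ.contDiffAt (Ioi_mem_nhds (hlo.trans_le ht.1))).of_le (by exact_mod_cast le_top)
  have h : ∀ j : ℕ, ∃ C, j ≤ k → ∀ t ∈ Icc lo hi, |iteratedDeriv j φ t| ≤ C := by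
    intro j
    by_cases hj : j ≤ k
    · obtain ⟨C, hC⟩ := (isCompact_Icc (a := lo) (b := hi)).exists_bound_of_continuousOn
        (f := iteratedFDeriv ℝ j φ) fun t ht =>
          ((hφ' t ht).continuousAt_iteratedFDeriv (by exact_mod_cast hj)).continuousWithinAt
      refine ⟨C, fun _ t ht => ?_⟩
      have := hC t ht
      rwa [norm_iteratedFDeriv_eq_norm_iteratedDeriv] at this
    · exact ⟨0, fun h => (hj h).elim⟩
  choose C hC using h
  refine ⟨k.factorial * (∑ j ∈ Finset.range (k + 1), |C j|) * max 1 B ^ k, ?_⟩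
  filter_upwards [hB, hS] with i h1 h2
  refine h1.comp fun x hx => ⟨hφ' _ (h2 x hx), fun j hj => ?_⟩
  refine ((hC j hj _ (h2 x hx)).trans (le_abs_self _)).trans ?_
  exact Finset.single_le_sum (f := fun j => |C j|) (fun _ _ => abs_nonneg _)
    (Finset.mem_range.2 (by lia))

end CkBounds

/-! ### Graphs of hypersurfaces of revolution over the shrinking cylinder -/

theorem inner_radialPart {m : ℕ} {w : Euc m} (hw : ‖w‖ = 1) (x : Euc m) :
    inner ℝ w (radialPart w x) = 0 := by
  simp [radialPart, inner_sub_right, inner_smul_right, hw]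

theorem norm_radialPart_sq {m : ℕ} {w : Euc m} (hw : ‖w‖ = 1) (x : Euc m) :
    ‖radialPart w x‖ ^ 2 = ‖x‖ ^ 2 - inner ℝ w x ^ 2 := by
  rw [radialPart, norm_sub_sq_real, norm_smul, hw, inner_smul_right, real_inner_comm x w]
  simp
  ring

/-- The linear functional `(s, x) ↦ ⟨v, x⟩` on space-time. -/
noncomputable def spaceInner {m : ℕ} (v : Euc m) : ℝ × Euc m →L[ℝ] ℝ :=
  (innerSL ℝ v).comp (ContinuousLinearMap.snd ℝ ℝ (Euc m))

theorem spaceInner_apply {m : ℕ} (v : Euc m) (q : ℝ × Euc m) :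
    spaceInner v q = inner ℝ v q.2 := rfl

theorem norm_spaceInner_le {m : ℕ} (v : Euc m) : ‖spaceInner v‖ ≤ ‖v‖ := by
  refine ContinuousLinearMap.opNorm_le_bound _ (norm_nonneg _) fun q => ?_
  rw [spaceInner_apply]
  exact (norm_inner_le_norm v q.2).trans (mul_le_mul_of_nonneg_left (norm_snd_le q) (norm_nonneg _))

/-- The squared radius, at time `s` and height `z`, of a hypersurface of revolution that is close to
the shrinking cylinder with squared radius `1 - 2 N s`. The parameters `κ` and `μ` are a small shift
in time and a small slope, and `e` is a small error. -/
noncomputable def sectionSq (N κ μ : ℝ) (e : ℝ → ℝ) (s z : ℝ) : ℝ :=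
  1 - 2 * N * s + 2 * N * (μ * z + κ) + e (1 / (2 * N) - s + (μ * z + κ))

/-- The component of `a` in the direction of the outward normal of the cylinders around `ℝ w`. -/
noncomputable def normalShift {m : ℕ} (w a : Euc m) (q : ℝ × Euc m) : ℝ :=
  inner ℝ a q.2 * (√(‖q.2‖ ^ 2 - inner ℝ w q.2 ^ 2))⁻¹

/-- The height over the shrinking cylinder around `ℝ w`, along its normals, of the hypersurface of
revolution around the axis `-a + ℝ w` with cross sections of squared radius `sectionSq`. -/
noncomputable def neckGraph {m : ℕ} (N : ℝ) (w a : Euc m) (κ μ : ℝ) (e : ℝ → ℝ)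
    (q : ℝ × Euc m) : ℝ :=
  -normalShift w a q + (√(normalShift w a q ^ 2 - ‖a‖ ^ 2 +
    sectionSq N κ μ e q.1 (inner ℝ w q.2)) - √(1 - 2 * N * q.1))

/-- The part at heights `|z| ≤ R` of the space-time track of the shrinking cylinder. -/
def neckRegion {m : ℕ} (N R : ℝ) (w : Euc m) : Set (ℝ × Euc m) :=
  {q | q.1 ∈ Ioc (-1) 0 ∧ ‖radialPart w q.2‖ ^ 2 = 1 - 2 * N * q.1 ∧ |inner ℝ w q.2| ≤ R}

theorem norm_le_of_mem_neckRegion {m : ℕ} {N R : ℝ} {w : Euc m} (hw : ‖w‖ = 1) (hN : 1 ≤ N)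
    {q : ℝ × Euc m} (hq : q ∈ neckRegion N R w) : ‖q‖ ≤ 1 + 2 * N + R ^ 2 := by
  obtain ⟨⟨h1, h2⟩, h3, h4⟩ := hq
  rw [norm_radialPart_sq hw] at h3
  have h5 : inner ℝ w q.2 ^ 2 ≤ R ^ 2 := sq_le_sq' (neg_le_of_abs_le h4) (le_of_abs_le h4)
  refine max_le ?_ ?_
  · rw [Real.norm_eq_abs, abs_le]
    constructor <;> nlinarith [sq_nonneg R]
  · refine abs_le_of_sq_le_sq' ?_ (by positivity) |>.2
    have : ‖q.2‖ ^ 2 ≤ 1 + 2 * N + R ^ 2 := by nlinarith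
    nlinarith [sq_nonneg R]

theorem contDiffOn_sqrt : ContDiffOn ℝ ∞ (fun t : ℝ => √t) (Ioi 0) := fun _ ht =>
  (Real.contDiffAt_sqrt (ne_of_gt ht)).contDiffWithinAt

theorem contDiffOn_inv_sqrt : ContDiffOn ℝ ∞ (fun t : ℝ => (√t)⁻¹) (Ioi 0) :=
  contDiffOn_sqrt.inv fun _ ht => (Real.sqrt_pos.2 ht).ne'

theorem contDiffOn_inv_Ioi : ContDiffOn ℝ ∞ (fun t : ℝ => t⁻¹) (Ioi 0) :=
  contDiffOn_id.inv fun _ ht => (ne_of_gt ht)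

/-- If the axis tends to `ℝ w`, and the shift, the slope and the error tend to zero, then the height
of the hypersurface over the cylinder tends to zero with all derivatives. -/
theorem isCkNull_neckGraph {m : ℕ} {ι : Type*} {l : Filter ι} {w a : ι → Euc m} {κ μ : ι → ℝ}
    {e : ι → ℝ → ℝ} {N R : ℝ} {k : ℕ} (hN : 1 ≤ N)
    (hw : ∀ᶠ i in l, ‖w i‖ = 1) (ha : Tendsto a l (𝓝 0)) (hκ : Tendsto κ l (𝓝 0))
    (hμ : Tendsto μ l (𝓝 0))
    (he : ∀ η > 0, ∀ᶠ i in l, ∀ t ∈ Icc (1 / (4 * N)) 3, ContDiffAt ℝ k (e i) t ∧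
      ∀ j ≤ k, |iteratedDeriv j (e i) t| ≤ η) :
    IsCkNull l k (fun i => neckRegion N R (w i))
      fun i => neckGraph N (w i) (a i) (κ i) (μ i) (e i) := by
  have hS : ∀ᶠ i in l, ∀ q ∈ neckRegion N R (w i), ‖q‖ ≤ 1 + 2 * N + R ^ 2 := by
    filter_upwards [hw] with i hi q hq using norm_le_of_mem_neckRegion hi hN hq
  set S := fun i => neckRegion N R (w i) with hSdef
  have bz : IsCkBounded l k S fun i q => inner ℝ (w i) q.2 :=
    IsCkBounded.clm (L := fun i => spaceInner (w i)) (B := 1)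
      (hw.mono fun i hi => (norm_spaceInner_le _).trans hi.le) hS
  have na : IsCkNull l k S fun i q => inner ℝ (a i) q.2 :=
    IsCkNull.clm (L := fun i => spaceInner (a i))
      (squeeze_zero (fun _ => norm_nonneg _) (fun i => norm_spaceInner_le (a i))
        (by simpa using ha.norm)) hS
  have bx : IsCkBounded l k S fun _ q => ‖q.2‖ ^ 2 :=
    IsCkBounded.of_contDiff (F := fun q : ℝ × Euc m => ‖q.2‖ ^ 2) (contDiff_snd.norm_sq ℝ) hS
  have bY : IsCkBounded l k S fun _ q => 1 - 2 * N * q.1 :=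
    IsCkBounded.of_contDiff (F := fun q : ℝ × Euc m => 1 - 2 * N * q.1)
      (contDiff_const.sub (contDiff_const.mul contDiff_fst)) hS
  have bT : IsCkBounded l k S fun _ q => 1 / (2 * N) - q.1 :=
    IsCkBounded.of_contDiff (F := fun q : ℝ × Euc m => 1 / (2 * N) - q.1)
      (contDiff_const.sub contDiff_fst) hS
  have rY : ∀ i, ∀ q ∈ S i, 1 - 2 * N * q.1 ∈ Icc 1 (1 + 2 * N) := by
    intro i q hq
    obtain ⟨⟨h1, h2⟩, -, -⟩ := hq
    constructor <;> nlinarith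
  have bρ : IsCkBounded l k S fun i q => ‖q.2‖ ^ 2 - inner ℝ (w i) q.2 ^ 2 := by
    have := bx.add ((IsCkBounded.const (-1)).mul (bz.mul bz))
    refine this.congr (Eventually.of_forall fun i q _ => Eventually.of_forall fun q => ?_)
    simp only
    ring
  have rρ : ∀ᶠ i in l, ∀ q ∈ S i, ‖q.2‖ ^ 2 - inner ℝ (w i) q.2 ^ 2 ∈ Icc 1 (1 + 2 * N) := by
    filter_upwards [hw] with i hi q hq
    rw [← norm_radialPart_sq hi, hq.2.1]
    exact rY i q hq
  have nα : IsCkNull l k S fun i => normalShift (w i) (a i) :=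
    na.mul (bρ.comp contDiffOn_inv_sqrt one_pos rρ)
  have nτ : IsCkNull l k S fun i q => μ i * inner ℝ (w i) q.2 + κ i :=
    ((IsCkNull.of_tendsto hμ).mul bz).add (IsCkNull.of_tendsto hκ)
  have rτ : ∀ᶠ i in l, ∀ q ∈ S i, 1 / (2 * N) - q.1 + (μ i * inner ℝ (w i) q.2 + κ i) ∈
      Icc (1 / (4 * N)) 3 := by
    filter_upwards [nτ (1 / (4 * N)) (by positivity)] with i hi q hq
    have h1 := abs_le.1 (hi.abs_le hq)
    obtain ⟨⟨h2, h3⟩, -, -⟩ := hq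
    have h4 : 1 / (2 * N) = 2 * (1 / (4 * N)) := by field_simp; norm_num
    have h5 : 1 / (4 * N) ≤ 1 / 4 := by
      apply one_div_le_one_div_of_le <;> linarith
    constructor <;> linarith [h1.1, h1.2]
  have nE : IsCkNull l k S fun i q =>
      e i (1 / (2 * N) - q.1 + (μ i * inner ℝ (w i) q.2 + κ i)) :=
    IsCkNull.comp (bT.add nτ.isCkBounded) he rτ
  -- The difference of the squared radii of the hypersurface and of the cylinder.
  have nδ : IsCkNull l k S fun i q => normalShift (w i) (a i) q ^ 2 - ‖a i‖ ^ 2 +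
      sectionSq N (κ i) (μ i) (e i) q.1 (inner ℝ (w i) q.2) - (1 - 2 * N * q.1) := by
    have ha2 : Tendsto (fun i => -‖a i‖ ^ 2) l (𝓝 0) := by
      simpa using (ha.norm.pow 2).neg
    refine ((nα.mul nα.isCkBounded).add ((IsCkNull.of_tendsto ha2).add
      ((nτ.mul (IsCkBounded.const (2 * N))).add nE))).congr
        (Eventually.of_forall fun i q _ => Eventually.of_forall fun q => ?_)
    simp only [sectionSq]
    ring
  have bX : IsCkBounded l k S fun i q => normalShift (w i) (a i) q ^ 2 - ‖a i‖ ^ 2 +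
      sectionSq N (κ i) (μ i) (e i) q.1 (inner ℝ (w i) q.2) :=
    (bY.add nδ.isCkBounded).congr
        (Eventually.of_forall fun i q _ => Eventually.of_forall fun q => by ring)
  have rX : ∀ᶠ i in l, ∀ q ∈ S i, normalShift (w i) (a i) q ^ 2 - ‖a i‖ ^ 2 +
      sectionSq N (κ i) (μ i) (e i) q.1 (inner ℝ (w i) q.2) ∈ Icc (1 / 2) (2 + 2 * N) := by
    filter_upwards [nδ (1 / 2) (by norm_num)] with i hi q hq
    have h1 := abs_le.1 (hi.abs_le hq)
    have h2 := rY i q hq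
    constructor <;> linarith [h1.1, h1.2, h2.1, h2.2]
  have bsX := bX.comp contDiffOn_sqrt one_half_pos rX
  have bsY := bY.comp contDiffOn_sqrt one_pos (Eventually.of_forall rY)
  have binv := (bsX.add bsY).comp (lo := 1) (hi := (2 + 2 * N) + (1 + 2 * N)) contDiffOn_inv_Ioi
    one_pos (by
      filter_upwards [rX] with i hi q hq
      have h1 := rY i q hq
      have h2 := hi q hq
      have h3 : 1 ≤ √(1 - 2 * N * q.1) := Real.one_le_sqrt.2 h1.1
      have h4 := Real.sqrt_nonneg (normalShift (w i) (a i) q ^ 2 - ‖a i‖ ^ 2 +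
        sectionSq N (κ i) (μ i) (e i) q.1 (inner ℝ (w i) q.2))
      refine ⟨by linarith, add_le_add ?_ ?_⟩
      · refine Real.sqrt_le_iff.2 ⟨by linarith, h2.2.trans ?_⟩
        nlinarith
      · refine Real.sqrt_le_iff.2 ⟨by linarith, h1.2.trans ?_⟩
        nlinarith)
  refine ((nα.mul (IsCkBounded.const (-1))).add (nδ.mul binv)).congr ?_
  obtain ⟨B, hB⟩ := bX
  filter_upwards [rX, hB] with i h1 h2 q hq
  -- Near points of the region, the difference of the square roots is rationalized.
  have p1 : (0 : ℝ) < normalShift (w i) (a i) q ^ 2 - ‖a i‖ ^ 2 +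
      sectionSq N (κ i) (μ i) (e i) q.1 (inner ℝ (w i) q.2) := by linarith [(h1 q hq).1]
  have p2 : 0 < 1 - 2 * N * q.1 := by linarith [(rY i q hq).1]
  filter_upwards [(h2 q hq).1.continuousAt.eventually_const_lt p1,
    (show ContinuousAt (fun q : ℝ × Euc m => 1 - 2 * N * q.1) q by fun_prop).eventually_const_lt p2]
    with q' h3 h4
  set X := normalShift (w i) (a i) q' ^ 2 - ‖a i‖ ^ 2 +
      sectionSq N (κ i) (μ i) (e i) q'.1 (inner ℝ (w i) q'.2)
  set Y := 1 - 2 * N * q'.1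
  have h5 : 0 < √X := Real.sqrt_pos.2 h3
  have h6 : 0 < √Y := Real.sqrt_pos.2 h4
  have h7 : X - Y = (√X - √Y) * (√X + √Y) := by
    rw [← Real.sq_sqrt h3.le, ← Real.sq_sqrt h4.le, Real.sqrt_sq h5.le, Real.sqrt_sq h6.le]
    ring
  have h8 : √X + √Y ≠ 0 := by positivity
  change -normalShift (w i) (a i) q' + (√X - √Y) = _
  rw [h7, mul_assoc, mul_inv_cancel₀ h8]
  ring

section Radial

variable {m : ℕ} {w : Euc m}

theorem radialPart_add (w x y : Euc m) : radialPart w (x + y) = radialPart w x + radialPart w y := by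
  simp only [radialPart, inner_add_right, add_smul]
  abel

theorem radialPart_smul (w : Euc m) (c : ℝ) (x : Euc m) :
    radialPart w (c • x) = c • radialPart w x := by
  simp only [radialPart, inner_smul_right, smul_sub, mul_smul]

theorem radialPart_zero (w : Euc m) : radialPart w 0 = 0 := by simp [radialPart]

theorem radialPart_self (hw : ‖w‖ = 1) : radialPart w w = 0 := by
  simp [radialPart, hw]

theorem radialPart_of_inner_eq_zero {x : Euc m} (h : inner ℝ w x = 0) : radialPart w x = x := by
  simp [radialPart, h]

theorem radialPart_radialPart (hw : ‖w‖ = 1) (x : Euc m) :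
    radialPart w (radialPart w x) = radialPart w x :=
  radialPart_of_inner_eq_zero (inner_radialPart hw x)

theorem inner_smul_add_radialPart (w x : Euc m) : inner ℝ w x • w + radialPart w x = x := by
  simp [radialPart]

theorem inner_cylNormal (hw : ‖w‖ = 1) (x : Euc m) : inner ℝ w (cylNormal w x) = 0 := by
  simp [cylNormal, inner_smul_right, inner_radialPart hw]

theorem norm_smul_cylNormal (w x : Euc m) :
    ‖radialPart w x‖ • cylNormal w x = radialPart w x := by
  rw [cylNormal, smul_smul]
  by_cases h : radialPart w x = 0
  · simp [h]
  · rw [mul_inv_cancel₀ (norm_ne_zero_iff.2 h), one_smul]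

theorem norm_cylNormal {x : Euc m} (h : radialPart w x ≠ 0) : ‖cylNormal w x‖ = 1 := by
  rw [cylNormal, norm_smul, norm_inv, norm_norm, inv_mul_cancel₀ (norm_ne_zero_iff.2 h)]

theorem inner_cylProj (hw : ‖w‖ = 1) (ρ : ℝ) (x : Euc m) :
    inner ℝ w (cylProj w ρ x) = inner ℝ w x := by
  simp [cylProj, inner_add_right, inner_smul_right, hw, inner_cylNormal hw]

theorem radialPart_cylProj (hw : ‖w‖ = 1) (ρ : ℝ) (x : Euc m) :
    radialPart w (cylProj w ρ x) = ρ • cylNormal w x := by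
  rw [cylProj, radialPart_add, radialPart_smul, radialPart_self hw, smul_zero, zero_add,
    radialPart_of_inner_eq_zero (by rw [inner_smul_right, inner_cylNormal hw, mul_zero])]

theorem cylNormal_cylProj (hw : ‖w‖ = 1) {ρ : ℝ} (hρ : 0 < ρ) (x : Euc m) :
    cylNormal w (cylProj w ρ x) = cylNormal w x := by
  by_cases h : radialPart w x = 0
  · have h0 : cylNormal w x = 0 := by simp [cylNormal, h]
    rw [cylNormal, radialPart_cylProj hw, h0, smul_zero, smul_zero]
  · rw [cylNormal, radialPart_cylProj hw, norm_smul, norm_cylNormal h, mul_one,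
      Real.norm_of_nonneg hρ.le, smul_smul, inv_mul_cancel₀ hρ.ne', one_smul]

theorem cylProj_mem (hw : ‖w‖ = 1) {ρ : ℝ} (hρ : 0 < ρ) {x : Euc m} (h : radialPart w x ≠ 0) :
    cylProj w ρ x ∈ roundCylinder w ρ := by
  change ‖radialPart w (cylProj w ρ x)‖ = ρ
  rw [radialPart_cylProj hw, norm_smul, norm_cylNormal h, mul_one, Real.norm_of_nonneg hρ.le]

/-- For `a` orthogonal to the axis, the normal shift is the component of `a` along the normal. -/
theorem normalShift_eq (hw : ‖w‖ = 1) {a : Euc m} (ha : inner ℝ w a = 0) (q : ℝ × Euc m) :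
    normalShift w a q = inner ℝ a (cylNormal w q.2) := by
  rw [normalShift, ← norm_radialPart_sq hw, Real.sqrt_sq (norm_nonneg _), cylNormal,
    inner_smul_right, radialPart, inner_sub_right, inner_smul_right, real_inner_comm w a, ha,
    mul_zero, sub_zero, mul_comm]

theorem neckGraph_cylProj (hw : ‖w‖ = 1) {a : Euc m} (ha : inner ℝ w a = 0) {N κ μ ρ : ℝ}
    {e : ℝ → ℝ} (hρ : 0 < ρ) (s : ℝ) (x : Euc m) :
    neckGraph N w a κ μ e (s, cylProj w ρ x) = neckGraph N w a κ μ e (s, x) := by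
  simp only [neckGraph, normalShift_eq hw ha, cylNormal_cylProj hw hρ, inner_cylProj hw]

/-- The hypersurface of revolution with cross sections of squared radius `sectionSq` is the normal
graph of `neckGraph` over the cylinder. -/
theorem mem_graph_iff (hw : ‖w‖ = 1) {a : Euc m} (ha : inner ℝ w a = 0) {N κ μ s : ℝ}
    {e : ℝ → ℝ} (hs : 0 < 1 - 2 * N * s) {x : Euc m}
    (hG : ‖a‖ ^ 2 < sectionSq N κ μ e s (inner ℝ w x)) :
    ‖radialPart w x + a‖ ^ 2 = sectionSq N κ μ e s (inner ℝ w x) ↔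
      x ∈ (fun y => y + neckGraph N w a κ μ e (s, y) • cylNormal w y) ''
        roundCylinder w √(1 - 2 * N * s) := by
  have hρ : 0 < √(1 - 2 * N * s) := Real.sqrt_pos.2 hs
  set ρ := √(1 - 2 * N * s) with hρdef
  constructor
  · intro hx
    have hx0 : radialPart w x ≠ 0 := by
      intro h0
      rw [h0, zero_add] at hx
      exact hG.ne hx
    refine ⟨cylProj w ρ x, cylProj_mem hw hρ hx0, ?_⟩
    simp only [neckGraph_cylProj hw ha hρ, cylNormal_cylProj hw hρ]
    have hu : neckGraph N w a κ μ e (s, x) = ‖radialPart w x‖ - ρ := by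
      rw [neckGraph, normalShift_eq hw ha]
      simp only
      set α := inner ℝ a (cylNormal w x) with hα
      have e1 : inner ℝ (radialPart w x) a = ‖radialPart w x‖ * α := by
        rw [hα, ← inner_smul_right, norm_smul_cylNormal, real_inner_comm]
      rw [norm_add_sq_real, e1] at hx
      have ht : 0 < ‖radialPart w x‖ := norm_pos_iff.2 hx0
      have e2 : α ^ 2 - ‖a‖ ^ 2 + sectionSq N κ μ e s (inner ℝ w x) =
          (‖radialPart w x‖ + α) ^ 2 := by
        rw [← hx]; ring
      -- `‖radialPart w x‖` is the positive one of two roots of opposite signs.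
      have e3 : 0 ≤ ‖radialPart w x‖ + α := by nlinarith
      rw [e2, Real.sqrt_sq e3]
      ring
    rw [hu, cylProj, add_assoc, ← add_smul, add_sub_cancel, norm_smul_cylNormal,
      inner_smul_add_radialPart]
  · rintro ⟨y, hy, rfl⟩
    have hy : ‖radialPart w y‖ = ρ := hy
    have hy0 : radialPart w y ≠ 0 := norm_ne_zero_iff.1 (by rw [hy]; exact hρ.ne')
    have hz : ∀ c : ℝ, inner ℝ w (y + c • cylNormal w y) = inner ℝ w y := by
      intro c
      rw [inner_add_right, inner_smul_right, inner_cylNormal hw, mul_zero, add_zero]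
    simp only [hz] at hG ⊢
    set u := neckGraph N w a κ μ e (s, y) with hu
    rw [neckGraph, normalShift_eq hw ha] at hu
    simp only at hu
    rw [radialPart_add, radialPart_of_inner_eq_zero
      (by rw [inner_smul_right, inner_cylNormal hw, mul_zero] :
        inner ℝ w (u • cylNormal w y) = 0), ← norm_smul_cylNormal w y, hy, ← add_smul,
      norm_add_sq_real, norm_smul, norm_cylNormal hy0, inner_smul_left, real_inner_comm]
    set α := inner ℝ a (cylNormal w y)
    have e2 : 0 ≤ α ^ 2 - ‖a‖ ^ 2 + sectionSq N κ μ e s (inner ℝ w y) := by nlinarith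
    have e3 := Real.sq_sqrt e2
    have e4 : √(α ^ 2 - ‖a‖ ^ 2 + sectionSq N κ μ e s (inner ℝ w y)) = u + ρ + α := by
      rw [hu]; ring
    rw [e4] at e3
    simp only [Real.norm_eq_abs, mul_one, sq_abs, conj_trivial]
    linarith

end Radial

/-- If a family of flows consists inside the ball `B_{1/ε}(0)` of hypersurfaces of revolution with
cross sections of squared radius `sectionSq`, with parameters tending to those of the shrinking
cylinder, then the flows are eventually `ε`-close to the shrinking cylinder. -/
theorem eventually_isCloseToCylinder {n : ℕ} (hn : 2 ≤ n) {ι : Type*} {l : Filter ι}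
    {w a : ι → Euc (n + 1)} {κ μ : ι → ℝ} {e : ι → ℝ → ℝ} {ε : ℝ} (hε : 0 < ε)
    {M : ι → ℝ → Set (Euc (n + 1))}
    (hw : ∀ᶠ i in l, ‖w i‖ = 1) (hwa : ∀ᶠ i in l, inner ℝ (w i) (a i) = 0)
    (ha : Tendsto a l (𝓝 0)) (hκ : Tendsto κ l (𝓝 0)) (hμ : Tendsto μ l (𝓝 0))
    (he : ∀ k : ℕ, ∀ η > 0, ∀ᶠ i in l, ∀ t ∈ Icc (1 / (4 * ((n : ℝ) - 1))) 3,
      ContDiffAt ℝ k (e i) t ∧ ∀ j ≤ k, |iteratedDeriv j (e i) t| ≤ η)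
    (hM : ∀ᶠ i in l, ∀ s ∈ Ioc (-1 : ℝ) 0, ∀ x : Euc (n + 1), ‖x‖ < ε⁻¹ → (x ∈ M i s ↔
      ‖radialPart (w i) x + a i‖ ^ 2 =
        sectionSq ((n : ℝ) - 1) (κ i) (μ i) (e i) s (inner ℝ (w i) x))) :
    ∀ᶠ i in l, IsCloseToCylinder n ε (w i) (M i) := by
  have hN : (1 : ℝ) ≤ (n : ℝ) - 1 := by
    have : (2 : ℝ) ≤ n := by exact_mod_cast hn
    linarith
  set N : ℝ := (n : ℝ) - 1 with hNdef
  have ht : Tendsto (fun i => |μ i| * ε⁻¹ + |κ i|) l (𝓝 0) := by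
    simpa using (hμ.abs.mul_const ε⁻¹).add hκ.abs
  have hna : Tendsto (fun i => ‖a i‖) l (𝓝 0) := by simpa using ha.norm
  filter_upwards [hw, hwa, hM, he 0 (1 / 8) (by norm_num),
    hna.eventually_lt_const (show (0 : ℝ) < 1 / 2 by norm_num),
    ht.eventually_lt_const (show (0 : ℝ) < 1 / (16 * N) by positivity),
    isCkNull_neckGraph (R := ε⁻¹) (k := ⌊ε⁻¹⌋₊) hN hw ha hκ hμ (he _) ε hε]
    with i h1 h2 h3 h4 h5 h6 h7
  have hsec : ∀ s ∈ Ioc (-1 : ℝ) 0, ∀ z : ℝ, |z| ≤ ε⁻¹ →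
      ‖a i‖ ^ 2 < sectionSq N (κ i) (μ i) (e i) s z := by
    intro s hs z hz
    have g1 : |μ i * z + κ i| < 1 / (16 * N) := by
      refine lt_of_le_of_lt ((abs_add_le _ _).trans ?_) h6
      rw [abs_mul]
      gcongr
    have g2 := abs_lt.1 g1
    have g3 : 2 * N * (1 / (16 * N)) = 1 / 8 := by field_simp; norm_num
    have g4 : 1 / (2 * N) = 2 * (1 / (4 * N)) := by field_simp; norm_num
    have g5 : 1 / (16 * N) = (1 / 4) * (1 / (4 * N)) := by field_simp; norm_num
    have g6 : 1 / (4 * N) ≤ 1 / 4 := by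
      apply one_div_le_one_div_of_le <;> linarith
    have g7 : 0 < 1 / (4 * N) := by positivity
    have g8 := (h4 (1 / (2 * N) - s + (μ i * z + κ i))
      ⟨by linarith [hs.1, hs.2, g2.1], by linarith [hs.1, hs.2, g2.2]⟩).2 0 le_rfl
    rw [iteratedDeriv_zero] at g8
    have g9 := (abs_le.1 g8).1
    have g10 : -(1 / 8) ≤ 2 * N * (μ i * z + κ i) := by
      rw [← g3]
      nlinarith [g2.1]
    have g11 : ‖a i‖ ^ 2 ≤ 1 / 4 := by nlinarith [norm_nonneg (a i)]
    have g12 : 0 ≤ -(2 * N * s) := by nlinarith [hs.2]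
    rw [sectionSq]
    linarith
  have hpos : ∀ s ∈ Ioc (-1 : ℝ) 0, 0 < 1 - 2 * N * s := fun s hs => by nlinarith [hs.2]
  have hz : ∀ {x : Euc (n + 1)}, ‖x‖ < ε⁻¹ → |inner ℝ (w i) x| ≤ ε⁻¹ := by
    intro x hx
    have := abs_real_inner_le_norm (w i) x
    rw [h1, one_mul] at this
    exact this.trans hx.le
  refine ⟨fun s y => neckGraph N (w i) (a i) (κ i) (μ i) (e i) (s, y), fun s hs => ⟨?_, ?_⟩⟩
  · ext x
    simp only [mem_inter_iff, Metric.mem_ball, dist_zero_right]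
    refine and_congr_left fun hx => ?_
    rw [h3 s hs x hx]
    exact mem_graph_iff h1 h2 (hpos s hs) (hsec s hs _ (hz hx))
  · intro y hy hball
    have hy' : ‖radialPart (w i) y‖ = √(1 - 2 * N * s) := hy
    have hyR : |inner ℝ (w i) y| ≤ ε⁻¹ := by
      simp only [Metric.mem_ball, dist_zero_right] at hball
      rcases hball with hb | hb
      · exact hz hb
      · have := hz hb
        rwa [inner_add_right, inner_smul_right, inner_cylNormal h1, mul_zero, add_zero] at this
    have hmem : (s, y) ∈ neckRegion N ε⁻¹ (w i) :=
      ⟨hs, by rw [hy', Real.sq_sqrt (hpos s hs).le], hyR⟩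
    have hcongr : ∀ q ∈ Ioc (-1 : ℝ) 0 ×ˢ (univ : Set (Euc (n + 1))),
        normalExtension n (w i) (fun s y => neckGraph N (w i) (a i) (κ i) (μ i) (e i) (s, y)) q =
          neckGraph N (w i) (a i) (κ i) (μ i) (e i) q := fun q hq =>
      neckGraph_cylProj h1 h2 (Real.sqrt_pos.2 (hpos q.1 hq.1)) q.1 q.2
    have hq : (s, y) ∈ Ioc (-1 : ℝ) 0 ×ˢ (univ : Set (Euc (n + 1))) := ⟨hs, mem_univ _⟩
    obtain ⟨c1, c2⟩ := h7 _ hmem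
    refine ⟨c1.contDiffWithinAt.congr hcongr (hcongr _ hq), fun j hj => ?_⟩
    rw [iteratedFDerivWithin_congr hcongr hq, iteratedFDerivWithin_eq_iteratedFDeriv
      ((uniqueDiffOn_Ioc _ _).prod uniqueDiffOn_univ) (c1.of_le (by exact_mod_cast hj)) hq]
    exact c2 j hj

/-! ### From the translator equation to the profile equation -/

section Radial

variable {n : ℕ} {χ : ℝ → ℝ} {x : Euc n}

theorem hasFDerivAt_norm_of_ne_zero (hx : x ≠ 0) :
    HasFDerivAt (fun y : Euc n => ‖y‖) (‖x‖⁻¹ • innerSL ℝ x) x := by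
  have hx' : 0 < ‖x‖ := norm_pos_iff.2 hx
  have h := (hasStrictFDerivAt_norm_sq x).hasFDerivAt.sqrt (by positivity)
  simp only [Real.sqrt_sq (norm_nonneg _)] at h
  refine h.congr_fderiv ?_
  ext y
  simp only [smul_apply, innerSL_apply_apply, smul_eq_mul, nsmul_eq_mul]
  push_cast
  field_simp

theorem hasFDerivAt_radial {χ' : ℝ} (hx : x ≠ 0) (hχ : HasDerivAt χ χ' ‖x‖) :
    HasFDerivAt (fun y : Euc n => χ ‖y‖) ((χ' / ‖x‖) • innerSL ℝ x) x := by
  refine (hχ.comp_hasFDerivAt x (hasFDerivAt_norm_of_ne_zero hx)).congr_fderiv ?_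
  rw [smul_smul, div_eq_mul_inv]

/-- The Hessian of a radial function. -/
theorem iteratedFDeriv_two_radial (hχ : ContDiff ℝ ∞ χ) (hψ : ContDiff ℝ ∞ fun y : Euc n => χ ‖y‖)
    (hx : x ≠ 0) (a b : Euc n) :
    iteratedFDeriv ℝ 2 (fun y : Euc n => χ ‖y‖) x ![a, b] =
      deriv χ ‖x‖ / ‖x‖ * inner ℝ a b +
        (deriv (deriv χ) ‖x‖ - deriv χ ‖x‖ / ‖x‖) / ‖x‖ ^ 2 * inner ℝ x a * inner ℝ x b := by
  have hx' : 0 < ‖x‖ := norm_pos_iff.2 hx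
  have d1 : ∀ r, HasDerivAt χ (deriv χ r) r := fun r =>
    (contDiff_infty_iff_deriv.1 hχ).1.differentiableAt.hasDerivAt
  have d2 : ∀ r, HasDerivAt (deriv χ) (deriv (deriv χ) r) r := fun r =>
    (contDiff_infty_iff_deriv.1 (contDiff_infty_iff_deriv.1 hχ).2).1.differentiableAt.hasDerivAt
  rw [iteratedFDeriv_two_apply]
  simp only [Matrix.cons_val_zero, Matrix.cons_val_one]
  have hd : DifferentiableAt ℝ (fderiv ℝ fun y : Euc n => χ ‖y‖) x :=
    (hψ.fderiv_right (m := 1) (by norm_cast)).differentiable one_ne_zero |>.differentiableAt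
  have e1 : fderiv ℝ (fderiv ℝ fun y : Euc n => χ ‖y‖) x a b =
      fderiv ℝ (fun z => fderiv ℝ (fun y : Euc n => χ ‖y‖) z b) x a := by
    rw [fderiv_clm_apply hd (differentiableAt_const b)]
    simp
  have e2 : (fun z => fderiv ℝ (fun y : Euc n => χ ‖y‖) z b) =ᶠ[𝓝 x]
      fun z => deriv χ ‖z‖ / ‖z‖ * inner ℝ z b := by
    filter_upwards [isOpen_ne.mem_nhds hx] with z hz
    rw [(hasFDerivAt_radial hz (d1 ‖z‖)).fderiv]
    simp
  have d3 := hasFDerivAt_radial (n := n) hx ((d2 ‖x‖).div (hasDerivAt_id ‖x‖) hx'.ne')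
  have d4 := d3.mul ((hasFDerivAt_id x).inner ℝ (hasFDerivAt_const b x))
  rw [e1, e2.fderiv_eq]
  simp only [id, Pi.div_apply] at d4
  erw [d4.fderiv]
  simp
  field_simp

theorem graphMCFOperator_radial (hχ : ContDiff ℝ ∞ χ)
    (hψ : ContDiff ℝ ∞ fun y : Euc n => χ ‖y‖) (hx : x ≠ 0) :
    graphMCFOperator (fun y : Euc n => χ ‖y‖) x =
      deriv (deriv χ) ‖x‖ / (1 + deriv χ ‖x‖ ^ 2) + ((n : ℝ) - 1) * deriv χ ‖x‖ / ‖x‖ := by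
  have hx' : 0 < ‖x‖ := norm_pos_iff.2 hx
  have hg : gradient (fun y : Euc n => χ ‖y‖) x = (deriv χ ‖x‖ / ‖x‖) • x := by
    refine HasGradientAt.gradient ?_
    rw [hasGradientAt_iff_hasFDerivAt]
    refine (hasFDerivAt_radial hx
      (contDiff_infty_iff_deriv.1 hχ).1.differentiableAt.hasDerivAt).congr_fderiv ?_
    ext y
    simp
  have hs : ∑ i, inner ℝ x (EuclideanSpace.basisFun (Fin n) ℝ i) *
      inner ℝ x (EuclideanSpace.basisFun (Fin n) ℝ i) = ‖x‖ ^ 2 := by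
    rw [EuclideanSpace.norm_sq_eq]
    refine Finset.sum_congr rfl fun i _ => ?_
    simp [sq, EuclideanSpace.inner_single_right]
  have hb : ∀ i, inner ℝ (EuclideanSpace.basisFun (Fin n) ℝ i)
      (EuclideanSpace.basisFun (Fin n) ℝ i) = (1 : ℝ) := fun i => by simp
  rw [graphMCFOperator, hg,
    InnerProductSpace.laplacian_eq_iteratedFDeriv_orthonormalBasis _
      (EuclideanSpace.basisFun (Fin n) ℝ)]
  simp only [iteratedFDeriv_two_radial hχ hψ hx, hb, mul_one, Finset.sum_add_distrib,
    Finset.sum_const, Finset.card_univ, Fintype.card_fin, nsmul_eq_mul]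
  simp only [mul_assoc, ← Finset.mul_sum, hs]
  simp only [inner_smul_left, inner_smul_right, norm_smul, real_inner_self_eq_norm_sq,
    conj_trivial, norm_div, Real.norm_eq_abs, abs_norm]
  have e : (|deriv χ ‖x‖| / ‖x‖ * ‖x‖) ^ 2 = deriv χ ‖x‖ ^ 2 := by
    rw [div_mul_cancel₀ _ hx'.ne', sq_abs]
  have hp : 0 < 1 + deriv χ ‖x‖ ^ 2 := by positivity
  rw [e]
  field_simp
  ring

end Radial

namespace IsBowlProfile

variable {n : ℕ} {c : ℝ} {φ : ℝ → ℝ}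

/-- After rescaling to unit speed and moving the tip to the origin, the profile of a bowl soliton,
extended evenly, is a solution of the profile equation. -/
theorem isBowlCurve (hn : 2 ≤ n) (h : IsBowlProfile n c φ) :
    IsBowlCurve n fun r => c * (φ |r / c| - φ 0) := by
  have hc := h.speed_pos
  set e₀ : Euc n := EuclideanSpace.single ⟨0, by lia⟩ 1 with he₀
  have he : ‖e₀‖ = 1 := by simp [he₀]
  set χ : ℝ → ℝ := fun r => φ |r| with hχdef
  have hχe : χ = fun r => φ ‖r • e₀‖ := by
    funext r
    rw [norm_smul, he, mul_one, Real.norm_eq_abs]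
  have hχ : ContDiff ℝ ∞ χ := by
    rw [hχe]
    exact h.smooth.comp (contDiff_id.smul contDiff_const)
  have hψe : (fun x : Euc n => φ ‖x‖) = fun x => χ ‖x‖ := by
    funext x
    simp [hχdef]
  have hconv : StrictConvexOn ℝ univ χ := by
    refine ⟨convex_univ, fun x _ y _ hxy a b ha hb hab => ?_⟩
    have hne : x • e₀ ≠ y • e₀ := fun h0 => hxy (smul_left_injective ℝ
      (norm_ne_zero_iff.1 (by rw [he]; exact one_ne_zero)) h0)
    have := h.strictConvex.2 (mem_univ _) (mem_univ _) hne ha hb hab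
    rw [hχe]
    simpa only [smul_eq_mul, add_smul, mul_smul] using this
  have d1 : ∀ r, HasDerivAt χ (deriv χ r) r := fun r =>
    (contDiff_infty_iff_deriv.1 hχ).1.differentiableAt.hasDerivAt
  have hχ' := (contDiff_infty_iff_deriv.1 hχ).2
  have d2 : ∀ r, HasDerivAt (deriv χ) (deriv (deriv χ) r) r := fun r =>
    (contDiff_infty_iff_deriv.1 hχ').1.differentiableAt.hasDerivAt
  have heven : ∀ r, χ (-r) = χ r := fun r => by simp [hχdef]
  have hv0 : deriv χ 0 = 0 := by
    have h1 := deriv_comp_neg (f := χ) (x := 0)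
    simp only [heven, neg_zero] at h1
    linarith
  have hvpos : ∀ r > 0, 0 < deriv χ r := by
    intro r hr
    have h1 : χ 0 < χ r := by
      have := hconv.2 (mem_univ (-r)) (mem_univ r) (by linarith) one_half_pos one_half_pos
        (by norm_num)
      simp only [heven, smul_eq_mul] at this
      ring_nf at this
      exact this
    have h2 := hconv.convexOn.slope_le_deriv (mem_univ 0) (mem_univ r) hr
      (d1 r).differentiableAt
    refine lt_of_lt_of_le ?_ h2
    rw [slope_def_field]
    exact div_pos (by linarith) (by linarith)
  have hmono : Monotone (deriv χ) := monotoneOn_univ.1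
    (hconv.convexOn.monotoneOn_deriv fun r _ => (d1 r).differentiableAt)
  have hode : ∀ r > 0, deriv (deriv χ) r =
      (1 + deriv χ r ^ 2) * (c - ((n : ℝ) - 1) * deriv χ r / r) := by
    intro r hr
    have hr' : ‖r • e₀‖ = r := by rw [norm_smul, he, mul_one, Real.norm_of_nonneg hr.le]
    have h1 := h.translator (r • e₀)
    have h2 := h.smooth
    rw [hψe] at h1 h2
    rw [graphMCFOperator_radial hχ h2 (norm_ne_zero_iff.1 (by rw [hr']; exact hr.ne')), hr'] at h1
    have hp : 0 < 1 + deriv χ r ^ 2 := by positivity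
    rw [← h1]
    field_simp
    ring
  have g1 : deriv (fun r => c * (φ |r / c| - φ 0)) = fun r => deriv χ (r / c) := by
    funext r
    have := (((d1 (r / c)).comp r ((hasDerivAt_id r).div_const c)).sub_const (φ 0)).const_mul c
    refine (this.congr_deriv ?_).deriv
    field_simp
  have g2 : deriv (deriv fun r => c * (φ |r / c| - φ 0)) = fun r => deriv (deriv χ) (r / c) / c := by
    rw [g1]
    funext r
    have := (d2 (r / c)).comp r ((hasDerivAt_id r).div_const c)
    refine (this.congr_deriv ?_).deriv
    field_simp
  refine ⟨?_, by simp, by simp [g1, hv0], ?_, ?_, ?_⟩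
  · exact contDiff_const.mul ((hχ.comp (contDiff_id.div_const c)).sub contDiff_const)
  · intro r hr
    rw [g1]
    exact hvpos _ (by positivity)
  · intro r _
    rw [g2]
    exact div_nonneg hmono.deriv_nonneg hc.le
  · intro r hr
    rw [g2, g1]
    simp only
    rw [hode (r / c) (by positivity)]
    field_simp

end IsBowlProfile

/-! ### Necks in zero sets of convex functions -/

theorem exists_unit_inner_eq_zero {m : ℕ} (hm : 2 ≤ m) (w : Euc m) :
    ∃ v : Euc m, ‖v‖ = 1 ∧ inner ℝ w v = 0 := by
  have h1 : Module.finrank ℝ (Submodule.span ℝ {w}) ≤ 1 :=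
    (finrank_span_le_card ({w} : Set (Euc m))).trans (by simp)
  have h2 := Submodule.finrank_add_finrank_orthogonal (Submodule.span ℝ {w})
  rw [finrank_euclideanSpace_fin] at h2
  have h3 : (Submodule.span ℝ {w})ᗮ ≠ ⊥ := by
    intro h0
    rw [h0, finrank_bot] at h2
    lia
  obtain ⟨v, hv, hv0⟩ := Submodule.exists_mem_ne_zero_of_ne_bot h3
  refine ⟨‖v‖⁻¹ • v, ?_, ?_⟩
  · rw [norm_smul, norm_inv, norm_norm, inv_mul_cancel₀ (norm_ne_zero_iff.2 hv0)]
  · rw [inner_smul_right, Submodule.mem_orthogonal_singleton_iff_inner_right.1 hv, mul_zero]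

section Neck

variable {n : ℕ} {ε : ℝ} {w' : Euc (n + 1)} {f : Euc (n + 1) → ℝ} {N : ℝ → Set (Euc (n + 1))}

/-- On each normal ray of the model cylinder in the ball, the neck has a point at distance between
`1 - ε` and `1 + ε` from the axis. -/
theorem IsCloseToCylinder.exists_mem (hε : 0 < ε) (hε' : ε ≤ 1 / 100) (hw' : ‖w'‖ = 1)
    (hN : IsCloseToCylinder n ε w' N) {v : Euc (n + 1)} (hv : ‖v‖ = 1) (hwv : inner ℝ w' v = 0)
    {z : ℝ} (hz : |z| ≤ ε⁻¹ - 2) :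
    ∃ ρ, 1 - ε ≤ ρ ∧ ρ ≤ 1 + ε ∧ z • w' + ρ • v ∈ N 0 := by
  obtain ⟨u, hu⟩ := hN
  obtain ⟨h1, h2⟩ := hu 0 (by norm_num)
  have hm : modelRadius n 0 = 1 := by simp [modelRadius]
  rw [hm] at h1 h2
  have hr : radialPart w' (z • w' + v) = v := by
    rw [radialPart_add, radialPart_smul, radialPart_self hw', smul_zero, zero_add,
      radialPart_of_inner_eq_zero hwv]
  have hnor : cylNormal w' (z • w' + v) = v := by simp [cylNormal, hr, hv]
  have hy : z • w' + v ∈ roundCylinder w' 1 := by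
    change ‖radialPart w' (z • w' + v)‖ = 1
    rw [hr, hv]
  have hnorm : ∀ ρ : ℝ, ‖z • w' + ρ • v‖ ≤ |z| + |ρ| := by
    intro ρ
    refine (norm_add_le _ _).trans ?_
    rw [norm_smul, norm_smul, hw', hv, mul_one, mul_one, Real.norm_eq_abs, Real.norm_eq_abs]
  have hb : z • w' + v ∈ Metric.ball (0 : Euc (n + 1)) ε⁻¹ := by
    rw [mem_ball_zero_iff]
    have := hnorm 1
    rw [one_smul, abs_one] at this
    linarith
  have h3 := ((h2 _ hy (Or.inl hb)).2 0 (Nat.zero_le _))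
  have hproj : cylProj w' 1 (z • w' + v) = z • w' + v := by
    rw [cylProj, hnor, inner_add_right, inner_smul_right, hwv, real_inner_self_eq_norm_sq, hw']
    simp
  rw [norm_iteratedFDerivWithin_zero, normalExtension] at h3
  simp only [hm, hproj] at h3
  rw [Real.norm_eq_abs] at h3
  have h4 := abs_le.1 h3
  set c := u 0 (z • w' + v)
  refine ⟨1 + c, by linarith, by linarith, ?_⟩
  have h5 : z • w' + (1 + c) • v ∈ N 0 ∩ Metric.ball (0 : Euc (n + 1)) ε⁻¹ := by
    rw [h1]
    refine ⟨⟨z • w' + v, hy, ?_⟩, ?_⟩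
    · simp only [hnor]
      rw [add_smul, one_smul, add_assoc]
    · rw [mem_ball_zero_iff]
      have := hnorm (1 + c)
      rw [abs_of_pos (by linarith : 0 < 1 + c)] at this
      linarith
  exact h5.1

/-- The neck does not meet the axis of the model cylinder in the ball. -/
theorem IsCloseToCylinder.smul_notMem (hε : 0 < ε) (hε' : ε ≤ 1 / 100) (hw' : ‖w'‖ = 1)
    (hN : IsCloseToCylinder n ε w' N) {z : ℝ} (hz : |z| ≤ ε⁻¹ - 2) : z • w' ∉ N 0 := by
  intro hmem
  obtain ⟨u, hu⟩ := hN
  obtain ⟨h1, h2⟩ := hu 0 (by norm_num)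
  have hm : modelRadius n 0 = 1 := by simp [modelRadius]
  rw [hm] at h1 h2
  have hb : z • w' ∈ Metric.ball (0 : Euc (n + 1)) ε⁻¹ := by
    rw [mem_ball_zero_iff, norm_smul, hw', mul_one, Real.norm_eq_abs]
    linarith
  obtain ⟨⟨y, hy, hyz⟩, -⟩ := h1.subset ⟨hmem, hb⟩
  have h3 := (h2 y hy (Or.inr (by simp only at hyz; rw [hyz]; exact hb))).2 0 (Nat.zero_le _)
  have hy1 : ‖radialPart w' y‖ = 1 := hy
  have hn : cylNormal w' y = radialPart w' y := by rw [cylNormal, hy1, inv_one, one_smul]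
  have hproj : cylProj w' 1 y = y := by
    rw [cylProj, hn, one_smul, inner_smul_add_radialPart]
  rw [norm_iteratedFDerivWithin_zero, normalExtension] at h3
  simp only [hm, hproj] at h3
  rw [Real.norm_eq_abs] at h3
  have h4 := congrArg (radialPart w') hyz
  simp only [hn] at h4
  rw [radialPart_add, radialPart_smul, radialPart_smul, radialPart_radialPart hw',
    radialPart_self hw', smul_zero] at h4
  have h5 : (1 + u 0 y) • radialPart w' y = 0 := by rw [add_smul, one_smul, h4]
  rcases smul_eq_zero.1 h5 with h6 | h6
  · have := (abs_le.1 h3).1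
    linarith
  · rw [h6, norm_zero] at hy1
    exact zero_ne_one hy1

/-- If the neck is the zero set of a convex function, then this function is negative on the axis of
the model cylinder: the axis contains points of segments between opposite points of the neck. -/
theorem IsCloseToCylinder.neg_on_axis (hn : 2 ≤ n) (hε : 0 < ε) (hε' : ε ≤ 1 / 100)
    (hw' : ‖w'‖ = 1) (hN : IsCloseToCylinder n ε w' N) (hf : ConvexOn ℝ univ f)
    (hNf : ∀ x, x ∈ N 0 ↔ f x = 0) {z : ℝ} (hz : |z| ≤ ε⁻¹ - 2) : f (z • w') < 0 := by
  obtain ⟨v, hv, hwv⟩ := exists_unit_inner_eq_zero (by lia : 2 ≤ n + 1) w'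
  obtain ⟨ρ, h1, -, h2⟩ := hN.exists_mem hε hε' hw' hv hwv hz
  obtain ⟨σ, h3, -, h4⟩ := hN.exists_mem (v := -v) hε hε' hw' (by rw [norm_neg, hv])
    (by rw [inner_neg_right, hwv, neg_zero]) hz
  rw [hNf] at h2 h4
  have hρ : 0 < ρ := by linarith
  have hσ : 0 < σ := by linarith
  have key := hf.2 (mem_univ (z • w' + ρ • v)) (mem_univ (z • w' + σ • -v))
    (div_nonneg hσ.le (add_pos hρ hσ).le) (div_nonneg hρ.le (add_pos hρ hσ).le)
    (by field_simp; ring)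
  have e : (σ / (ρ + σ)) • (z • w' + ρ • v) + (ρ / (ρ + σ)) • (z • w' + σ • -v) = z • w' := by
    have : ρ + σ ≠ 0 := (add_pos hρ hσ).ne'
    match_scalars <;> field_simp <;> ring
  rw [e, h2, h4, smul_zero, smul_zero, add_zero] at key
  exact key.lt_of_ne fun h0 => hN.smul_notMem hε hε' hw' hz ((hNf _).2 h0)

theorem IsCloseToCylinder.neg_inside (hn : 2 ≤ n) (hε : 0 < ε) (hε' : ε ≤ 1 / 100)
    (hw' : ‖w'‖ = 1) (hN : IsCloseToCylinder n ε w' N) (hf : ConvexOn ℝ univ f)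
    (hNf : ∀ x, x ∈ N 0 ↔ f x = 0) {x : Euc (n + 1)} (hz : |inner ℝ w' x| ≤ ε⁻¹ - 2)
    (hx : ‖radialPart w' x‖ < 1 - ε) : f x < 0 := by
  have h0 := hN.neg_on_axis hn hε hε' hw' hf hNf hz
  by_cases hr : radialPart w' x = 0
  · have := inner_smul_add_radialPart w' x
    rw [hr, add_zero] at this
    rwa [this] at h0
  obtain ⟨ρ, h1, -, h2⟩ := hN.exists_mem hε hε' hw' (norm_cylNormal hr) (inner_cylNormal hw' x) hz
  rw [hNf] at h2
  set r := ‖radialPart w' x‖ with hrdef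
  have hρ : 0 < ρ := by linarith
  have hlt : r / ρ < 1 := (div_lt_one hρ).2 (by linarith)
  have key := hf.2 (mem_univ (inner ℝ w' x • w'))
    (mem_univ (inner ℝ w' x • w' + ρ • cylNormal w' x)) (sub_nonneg.2 hlt.le)
    (div_nonneg (norm_nonneg _) hρ.le) (by ring)
  have e : (1 - r / ρ) • inner ℝ w' x • w' +
      (r / ρ) • (inner ℝ w' x • w' + ρ • cylNormal w' x) = x := by
    nth_rw 4 [← inner_smul_add_radialPart w' x]
    rw [← norm_smul_cylNormal w' x, ← hrdef]
    match_scalars <;> field_simp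
    ring
  rw [e, h2, smul_zero, add_zero, smul_eq_mul] at key
  exact key.trans_lt (mul_neg_of_pos_of_neg (by linarith) h0)

theorem IsCloseToCylinder.pos_outside (hn : 2 ≤ n) (hε : 0 < ε) (hε' : ε ≤ 1 / 100)
    (hw' : ‖w'‖ = 1) (hN : IsCloseToCylinder n ε w' N) (hf : ConvexOn ℝ univ f)
    (hNf : ∀ x, x ∈ N 0 ↔ f x = 0) {x : Euc (n + 1)} (hz : |inner ℝ w' x| ≤ ε⁻¹ - 2)
    (hx : 1 + ε < ‖radialPart w' x‖) : 0 < f x := by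
  have h0 := hN.neg_on_axis hn hε hε' hw' hf hNf hz
  have hr : radialPart w' x ≠ 0 := norm_ne_zero_iff.1 (by linarith)
  obtain ⟨ρ, h1, h1', h2⟩ := hN.exists_mem hε hε' hw' (norm_cylNormal hr) (inner_cylNormal hw' x) hz
  rw [hNf] at h2
  set r := ‖radialPart w' x‖ with hrdef
  have hρ : 0 < ρ := by linarith
  have hr0 : 0 < r := by linarith
  have hlt : ρ / r < 1 := (div_lt_one hr0).2 (by linarith)
  have key := hf.2 (mem_univ (inner ℝ w' x • w')) (mem_univ x) (sub_nonneg.2 hlt.le)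
    (div_nonneg hρ.le hr0.le) (by ring)
  have e : (1 - ρ / r) • inner ℝ w' x • w' + (ρ / r) • x =
      inner ℝ w' x • w' + ρ • cylNormal w' x := by
    nth_rw 2 [← inner_smul_add_radialPart w' x]
    rw [← norm_smul_cylNormal w' x, ← hrdef]
    match_scalars <;> field_simp
    ring
  rw [e, h2, smul_eq_mul, smul_eq_mul] at key
  have h5 : 0 < 1 - ρ / r := by linarith
  have h6 : 0 < ρ / r := by positivity
  by_contra! h7
  nlinarith [mul_neg_of_pos_of_neg h5 h0, mul_nonpos_of_nonneg_of_nonpos h6.le h7]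

/-- If the neck is the zero set of a convex function that does not increase in the direction `w`,
then `w` is almost parallel to the axis of the neck, since rays in the sublevel set cannot leave the
neck sideways. This bounds the cross section orthogonal to `w`, and makes the sublevel set long in
the direction `-w`. -/
theorem IsCloseToCylinder.control (hn : 2 ≤ n) (hε : 0 < ε) (hε' : ε ≤ 1 / 100)
    (hw' : ‖w'‖ = 1) (hN : IsCloseToCylinder n ε w' N) (hf : ConvexOn ℝ univ f)
    (hNf : ∀ x, x ∈ N 0 ↔ f x = 0) {w : Euc (n + 1)} (hw : ‖w‖ = 1)
    (hrec : ∀ t : ℝ, 0 ≤ t → f (t • w) ≤ f 0) :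
    (∀ x, inner ℝ w x = 0 → 2 ≤ ‖x‖ → 0 < f x) ∧ f (-(40 : ℝ) • w) < 0 := by
  have hL : 98 ≤ ε⁻¹ - 2 := by
    have : (100 : ℝ) ≤ ε⁻¹ := by
      rw [le_inv_comm₀ (by norm_num) hε]
      linarith
    linarith
  have f0 : f 0 < 0 := by
    have := hN.neg_on_axis hn hε hε' hw' hf hNf (z := 0) (by rw [abs_zero]; linarith)
    rwa [zero_smul] at this
  set α : ℝ := inner ℝ w' w with hα
  set β : ℝ := ‖radialPart w' w‖ with hβ
  have hαβ : β ^ 2 = 1 - α ^ 2 := by rw [hβ, norm_radialPart_sq hw', hw, one_pow]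
  have hβ0 : 0 ≤ β := norm_nonneg _
  have hα0 : 0 ≤ |α| := abs_nonneg _
  have hout : ∀ t : ℝ, 0 ≤ t → t * |α| ≤ ε⁻¹ - 2 → t * β ≤ 1 + ε := by
    intro t ht h1
    by_contra! h2
    have h3 := hN.pos_outside hn hε hε' hw' hf hNf (x := t • w)
      (by rwa [inner_smul_right, abs_mul, abs_of_nonneg ht])
      (by rwa [radialPart_smul, norm_smul, Real.norm_of_nonneg ht])
    linarith [hrec t ht]
  have hαle : |α| ≤ 1 := by
    have := abs_real_inner_le_norm w' w
    rwa [hw', hw, one_mul] at this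
  have hsmall : β ≤ 1 / 80 := by
    have := hout 98 (by norm_num) (by linarith)
    linarith
  have hα9 : 9 / 10 ≤ |α| := by
    have : (9 / 10 : ℝ) ^ 2 ≤ |α| ^ 2 := by
      rw [sq_abs]
      nlinarith
    exact le_of_sq_le_sq this hα0
  have h2pos : ∀ x, inner ℝ w x = 0 → ‖x‖ = 2 → 0 < f x := by
    intro x hx hx2
    have h1 : α * inner ℝ w' x = -inner ℝ (radialPart w' w) x := by
      have h2 : inner ℝ (α • w' + radialPart w' w) x = 0 := by
        rw [hα, inner_smul_add_radialPart, hx]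
      rw [inner_add_left, inner_smul_left] at h2
      simp only [conj_trivial] at h2
      linarith
    have h3 : |α| * |inner ℝ w' x| ≤ β * 2 := by
      rw [← abs_mul, h1, abs_neg, ← hx2]
      exact abs_real_inner_le_norm _ _
    have h4 : |inner ℝ w' x| ≤ 1 / 10 := by
      have := abs_nonneg (inner ℝ w' x)
      nlinarith
    refine hN.pos_outside hn hε hε' hw' hf hNf (by linarith) ?_
    have h5 : (1 + ε) ^ 2 < ‖radialPart w' x‖ ^ 2 := by
      rw [norm_radialPart_sq hw', hx2, ← sq_abs (inner ℝ w' x)]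
      nlinarith [abs_nonneg (inner ℝ w' x)]
    exact lt_of_pow_lt_pow_left₀ 2 (norm_nonneg _) h5
  refine ⟨fun x hx hx2 => ?_, ?_⟩
  · have hx0 : 0 < ‖x‖ := by linarith
    have h1 := h2pos ((2 / ‖x‖) • x) (by rw [inner_smul_right, hx, mul_zero])
      (by rw [norm_smul, Real.norm_of_nonneg (by positivity)]; field_simp)
    have hle : 2 / ‖x‖ ≤ 1 := (div_le_one hx0).2 hx2
    have key := hf.2 (mem_univ (0 : Euc (n + 1))) (mem_univ x) (sub_nonneg.2 hle)
      (by positivity : (0 : ℝ) ≤ 2 / ‖x‖) (by ring)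
    rw [smul_zero, zero_add, smul_eq_mul, smul_eq_mul] at key
    have h2 : 0 < 2 / ‖x‖ := by positivity
    by_contra! h3
    nlinarith [mul_nonpos_of_nonneg_of_nonpos (sub_nonneg.2 hle) f0.le,
      mul_nonpos_of_nonneg_of_nonpos h2.le h3]
  · refine hN.neg_inside hn hε hε' hw' hf hNf ?_ ?_
    · rw [inner_smul_right, abs_mul, abs_neg, abs_of_pos (by norm_num : (0 : ℝ) < 40)]
      linarith
    · rw [radialPart_smul, norm_smul, norm_neg, Real.norm_of_nonneg (by norm_num : (0 : ℝ) ≤ 40)]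
      linarith

end Neck

/-! ### Position and scale of a flow with a neck -/

theorem mem_rescale_iff {m : ℕ} {r : ℝ} (hr : 0 < r) {p x : Euc m} {A : Set (Euc m)} :
    x ∈ (fun y => r⁻¹ • (y - p)) '' A ↔ r • x + p ∈ A := by
  constructor
  · rintro ⟨y, hy, rfl⟩
    rwa [smul_smul, mul_inv_cancel₀ hr.ne', one_smul, sub_add_cancel]
  · intro h
    refine ⟨_, h, ?_⟩
    simp only [add_sub_cancel_right]
    rw [smul_smul, inv_mul_cancel₀ hr.ne', one_smul]

/-- A convex increasing function of the distance to a line is convex. -/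
theorem convexOn_comp_norm_radialPart {m : ℕ} {χ : ℝ → ℝ} (hχ : ConvexOn ℝ (Ici 0) χ)
    (hm : MonotoneOn χ (Ici 0)) (w v : Euc m) (r : ℝ) :
    ConvexOn ℝ univ fun x => χ ‖radialPart w (r • x + v)‖ := by
  refine ⟨convex_univ, fun x _ y _ a b ha hb hab => ?_⟩
  have e : r • (a • x + b • y) + v = a • (r • x + v) + b • (r • y + v) := by
    have hv : v = a • v + b • v := by rw [← add_smul, hab, one_smul]
    conv_lhs => rw [hv]
    module
  simp only [e, radialPart_add _ (a • _), radialPart_smul _ a, radialPart_smul _ b]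
  refine (hm (norm_nonneg _) ?_ (norm_add_le _ _)).trans ?_
  · exact add_nonneg (norm_nonneg _) (norm_nonneg _)
  · rw [norm_smul, norm_smul, Real.norm_of_nonneg ha, Real.norm_of_nonneg hb]
    exact hχ.2 (norm_nonneg _) (norm_nonneg _) ha hb hab

namespace HasStrongNeck

variable {n : ℕ} {ε : ℝ} {M : ℝ → Set (Euc (n + 1))} {p q w : Euc (n + 1)}

/-- The neck bounds the extinction time of a cylindrical flow, and the distance of its axis from the
center of the neck. -/
theorem cylinder_control (hn : 2 ≤ n) (hε : 0 < ε) (hε' : ε ≤ 1 / 100)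
    (h : HasStrongNeck n ε M p √(2 * ((n : ℝ) - 1)) (-1)) (hw : ‖w‖ = 1) {T : ℝ}
    (hM : ∀ t, M t = {x | t < T ∧ x - q ∈ roundCylinder w √(2 * ((n : ℝ) - 1) * (T - t))}) :
    |T| ≤ 15 ∧ ‖radialPart w (p - q)‖ ≤ 2 * √(2 * ((n : ℝ) - 1)) := by
  obtain ⟨hr, w', hw', hN⟩ := h
  set r := √(2 * ((n : ℝ) - 1)) with hrdef
  have hn' : (2 : ℝ) ≤ n := by exact_mod_cast hn
  have hmem : ∀ x, x ∈ (fun y => r⁻¹ • (y - p)) '' M (-1 + r ^ 2 * 0) ↔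
      -1 < T ∧ ‖radialPart w (r • x + (p - q))‖ = √(2 * ((n : ℝ) - 1) * (T + 1)) := by
    intro x
    rw [mem_rescale_iff hr, hM, mem_ofPred_eq, roundCylinder, mem_ofPred_eq, mul_zero, add_zero,
      sub_neg_eq_add, add_sub_assoc]
  -- Otherwise the flow would be extinct, and the neck the empty zero set of a positive constant.
  have hT : -1 < T := by
    by_contra hT
    have := hN.neg_on_axis hn hε hε' hw' (f := fun _ => 1) (convexOn_const 1 convex_univ)
      (fun x => by simp only [hmem, hT, false_and, one_ne_zero]) (z := 0)
      (by
        rw [abs_zero]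
        have : (100 : ℝ) ≤ ε⁻¹ := by
          rw [le_inv_comm₀ (by norm_num) hε]
          linarith
        linarith)
    linarith
  set ρ := √(2 * ((n : ℝ) - 1) * (T + 1)) with hρ
  have hf : ConvexOn ℝ univ fun x => ‖radialPart w (r • x + (p - q))‖ + -ρ :=
    (convexOn_comp_norm_radialPart (χ := id) (convexOn_id (convex_Ici 0))
      (monotone_id.monotoneOn _) w (p - q) r).add (convexOn_const _ convex_univ)
  obtain ⟨c1, -⟩ := hN.control hn hε hε' hw' hf
    (fun x => by simp only [hmem, hT, true_and]; constructor <;> intro <;> linarith) hw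
    (fun t _ => by
      simp only [smul_zero, zero_add, radialPart_add, radialPart_smul, radialPart_self hw, le_refl])
  have hb : ‖radialPart w (p - q)‖ ≤ 2 * r := by
    by_contra! hb
    have h1 := c1 (-r⁻¹ • radialPart w (p - q))
      (by rw [inner_smul_right, inner_radialPart hw, mul_zero])
      (by
        rw [norm_smul, norm_neg, norm_inv, Real.norm_of_nonneg hr.le, inv_mul_eq_div,
          le_div_iff₀ hr]
        exact hb.le)
    rw [radialPart_add, radialPart_smul, radialPart_smul, radialPart_radialPart hw, smul_smul,
      mul_neg, mul_inv_cancel₀ hr.ne', neg_one_smul, neg_add_cancel, norm_zero] at h1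
    linarith [Real.sqrt_nonneg (2 * ((n : ℝ) - 1) * (T + 1))]
  refine ⟨?_, hb⟩
  obtain ⟨v, hv, hwv⟩ := exists_unit_inner_eq_zero (by lia : 2 ≤ n + 1) w
  have h2 := c1 ((2 : ℝ) • v) (by rw [inner_smul_right, hwv, mul_zero])
    (by rw [norm_smul, hv]; norm_num)
  have h3 : ‖radialPart w (r • (2 : ℝ) • v + (p - q))‖ ≤ 4 * r := by
    rw [radialPart_add, radialPart_smul, radialPart_smul, radialPart_of_inner_eq_zero hwv]
    refine (norm_add_le _ _).trans ?_
    rw [norm_smul, norm_smul, hv, Real.norm_of_nonneg hr.le, Real.norm_of_nonneg zero_le_two]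
    linarith
  have h4 : ρ ≤ 4 * r := by linarith
  have h5 : 2 * ((n : ℝ) - 1) * (T + 1) ≤ 16 * (2 * ((n : ℝ) - 1)) := by
    have h6 := pow_le_pow_left₀ (Real.sqrt_nonneg _) h4 2
    have h7 : 0 ≤ 2 * ((n : ℝ) - 1) := by linarith
    rw [mul_pow, hrdef, Real.sq_sqrt h7, Real.sq_sqrt (mul_nonneg h7 (by linarith))] at h6
    linarith
  rw [abs_le]
  constructor <;> nlinarith

end HasStrongNeck

/-- By uniqueness, all bowl solitons are rescaled and translated copies of a single one. -/
theorem IsBowlProfile.eq_rescaled {n : ℕ} (hn : 2 ≤ n) {c : ℝ} {φ χ : ℝ → ℝ}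
    (h : IsBowlProfile n c φ) (hχ : IsBowlCurve n χ) {r : ℝ} (hr : 0 ≤ r) :
    φ r = φ 0 + χ (c * r) / c := by
  have hc := h.speed_pos
  rw [hχ.unique hn (h.isBowlCurve hn) (by positivity : 0 ≤ c * r),
    mul_div_cancel_left₀ _ hc.ne', mul_div_cancel_left₀ _ hc.ne', abs_of_nonneg hr]
  ring

/-- The neck bounds the speed of a bowl soliton from below. It also bounds the distance of its axis
from the center of the neck, and the time at which the tip is at the height of the center, which is
`(⟨w, p - q⟩ - φ 0) / c`. -/
theorem HasStrongNeck.bowl_control {n : ℕ} {ε : ℝ} {M : ℝ → Set (Euc (n + 1))}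
    {p q w : Euc (n + 1)} (hn : 2 ≤ n) (hε : 0 < ε) (hε' : ε ≤ 1 / 100)
    (h : HasStrongNeck n ε M p √(2 * ((n : ℝ) - 1)) (-1)) (hw : ‖w‖ = 1) {c : ℝ} {φ χ : ℝ → ℝ}
    (hφ : IsBowlProfile n c φ) (hχ : IsBowlCurve n χ)
    (hM : ∀ t, M t = {x | inner ℝ w (x - q) = φ ‖radialPart w (x - q)‖ + c * t}) :
    1 ≤ c ∧ |inner ℝ w (p - q) - φ 0| ≤ 15 * c ∧
      ‖radialPart w (p - q)‖ ≤ 2 * √(2 * ((n : ℝ) - 1)) := by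
  obtain ⟨hr, w', hw', hN⟩ := h
  set r := √(2 * ((n : ℝ) - 1)) with hrdef
  have hn' : (2 : ℝ) ≤ n := by exact_mod_cast hn
  have hr2 : r ^ 2 = 2 * ((n : ℝ) - 1) := Real.sq_sqrt (by linarith)
  have hr1 : 1 ≤ r := Real.one_le_sqrt.2 (by linarith)
  have hc := hφ.speed_pos
  set H := inner ℝ w (p - q) - φ 0 with hH
  have hzero : ∀ y, 0 ≤ y → 0 ≤ χ y := fun y hy => by
    have := hχ.strictMonoOn.monotoneOn self_mem_Ici hy hy
    rwa [hχ.zero] at this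
  have hconv : ConvexOn ℝ (Ici 0) fun y => χ (c * y) / c := by
    refine ⟨convex_Ici 0, fun x hx y hy a b ha hb hab => ?_⟩
    have hx : 0 ≤ x := hx
    have hy : 0 ≤ y := hy
    have := hχ.convexOn.2 (mul_nonneg hc.le hx) (mul_nonneg hc.le hy) ha hb hab
    simp only [smul_eq_mul] at this ⊢
    rw [show a * (χ (c * x) / c) + b * (χ (c * y) / c) = (a * χ (c * x) + b * χ (c * y)) / c by ring,
      show c * (a * x + b * y) = a * (c * x) + b * (c * y) by ring]
    gcongr
  have hmono : MonotoneOn (fun y => χ (c * y) / c) (Ici 0) := by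
    intro x hx y hy hxy
    have hx : 0 ≤ x := hx
    have hy : 0 ≤ y := hy
    have := hχ.strictMonoOn.monotoneOn (mul_nonneg hc.le hx) (mul_nonneg hc.le hy)
      (mul_le_mul_of_nonneg_left hxy hc.le)
    simp only
    gcongr
  set f : Euc (n + 1) → ℝ := fun x =>
    χ (c * ‖radialPart w (r • x + (p - q))‖) / c + (-(r * inner ℝ w x) + (-(c + H))) with hfdef
  have hf : ConvexOn ℝ univ f := by
    refine (convexOn_comp_norm_radialPart hconv hmono w (p - q) r).add
      (ConvexOn.add ⟨convex_univ, fun x _ y _ a b _ _ _ => ?_⟩ (convexOn_const _ convex_univ))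
    simp only [inner_add_right, inner_smul_right, smul_eq_mul]
    linarith
  have hNf : ∀ x, x ∈ (fun y => r⁻¹ • (y - p)) '' M (-1 + r ^ 2 * 0) ↔ f x = 0 := by
    intro x
    rw [mem_rescale_iff hr, hM, mem_ofPred_eq, add_sub_assoc, inner_add_right, inner_smul_right,
      hφ.eq_rescaled hn hχ (norm_nonneg _), hfdef]
    constructor <;> intro <;> linarith
  obtain ⟨c1, c2⟩ := hN.control hn hε hε' hw' hf hNf hw (fun t ht => by
    simp only [hfdef, smul_zero, zero_add, radialPart_add, radialPart_smul, radialPart_self hw,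
      radialPart_zero, inner_smul_right, inner_zero_right, real_inner_self_eq_norm_sq, hw]
    nlinarith)
  have h40 : 40 * r < c + H := by
    simp only [hfdef, inner_smul_right, real_inner_self_eq_norm_sq, hw] at c2
    have := div_nonneg (hzero (c * ‖radialPart w (r • (-(40 : ℝ)) • w + (p - q))‖)
      (by positivity)) hc.le
    linarith
  have hb : ‖radialPart w (p - q)‖ ≤ 2 * r := by
    by_contra! hb
    have h1 := c1 (-r⁻¹ • radialPart w (p - q))
      (by rw [inner_smul_right, inner_radialPart hw, mul_zero])
      (by
        rw [norm_smul, norm_neg, norm_inv, Real.norm_of_nonneg hr.le, inv_mul_eq_div,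
          le_div_iff₀ hr]
        exact hb.le)
    simp only [hfdef] at h1
    rw [radialPart_add, radialPart_smul, radialPart_smul, radialPart_radialPart hw, smul_smul,
      mul_neg, mul_inv_cancel₀ hr.ne', neg_one_smul, neg_add_cancel, norm_zero, mul_zero, hχ.zero,
      inner_smul_right, inner_radialPart hw, zero_div, mul_zero, mul_zero] at h1
    linarith
  obtain ⟨v, hv, hwv⟩ := exists_unit_inner_eq_zero (by lia : 2 ≤ n + 1) w
  have h2 := c1 ((2 : ℝ) • v) (by rw [inner_smul_right, hwv, mul_zero])
    (by rw [norm_smul, hv]; norm_num)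
  have h3 : ‖radialPart w (r • (2 : ℝ) • v + (p - q))‖ ≤ 4 * r := by
    rw [radialPart_add, radialPart_smul, radialPart_smul, radialPart_of_inner_eq_zero hwv]
    refine (norm_add_le _ _).trans ?_
    rw [norm_smul, norm_smul, hv, Real.norm_of_nonneg hr.le, Real.norm_of_nonneg zero_le_two]
    linarith
  simp only [hfdef, inner_smul_right, hwv] at h2
  set y := ‖radialPart w (r • (2 : ℝ) • v + (p - q))‖ with hy
  have hy0 : 0 ≤ y := norm_nonneg _
  have h4 : c + H < χ (c * y) / c := by linarith
  have h5 := hχ.le_sq (by positivity : 0 ≤ c * y)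
  -- The height above the tip is at most `c y² / (2 (n - 1))`, where `y ≤ 4 √(2 (n - 1))`.
  have h6 : c + H ≤ 16 * c := by
    rw [lt_div_iff₀ hc] at h4
    have h7 : 2 * ((n : ℝ) - 1) * ((c + H) * c) ≤ (c * y) ^ 2 := by nlinarith
    have h8 : y ^ 2 ≤ 16 * (2 * ((n : ℝ) - 1)) := by
      rw [← hr2]
      nlinarith
    have h9 : 2 * ((n : ℝ) - 1) * ((c + H) * c) ≤ 2 * ((n : ℝ) - 1) * (16 * c * c) := by
      rw [mul_pow] at h7
      nlinarith [sq_nonneg c]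
    have h10 := le_of_mul_le_mul_left h9 (by linarith)
    exact le_of_mul_le_mul_right h10 hc
  refine ⟨by linarith, ?_, hb⟩
  rw [abs_le]
  constructor <;> linarith

/-! ### Convergence to the cylinder as time tends to minus infinity -/

theorem exists_time_of_eventually {ι : Type*} {t : ι → ℝ} {H P : ι → Prop}
    (h : ∀ᶠ i in comap t atBot ⊓ 𝓟 {i | H i}, P i) :
    ∃ T : ℝ, 0 < T ∧ ∀ i, H i → t i ≤ -T → P i := by
  rw [eventually_inf_principal, eventually_comap, eventually_atBot] at h
  obtain ⟨b, hb⟩ := h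
  refine ⟨max 1 (-b), by positivity, fun i hi hti => hb (t i) ?_ i rfl hi⟩
  linarith [le_max_right 1 (-b)]

/-- The parameters of a cylindrical flow seen at time `t` from the center `p`: extinction time, point
on the axis, direction of the axis. -/
structure CylinderView (n : ℕ) where
  T : ℝ
  q : Euc (n + 1)
  w : Euc (n + 1)
  p : Euc (n + 1)
  t : ℝ

/-- The parameters of a bowl soliton flow seen at time `t` from the center `p`: speed, profile,
a point on the axis from which heights are measured, direction of translation. -/
structure BowlView (n : ℕ) where
  c : ℝ
  φ : ℝ → ℝ
  q : Euc (n + 1)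
  w : Euc (n + 1)
  p : Euc (n + 1)
  t : ℝ

theorem tendsto_scale {ι : Type*} {t : ι → ℝ} {N : ℝ} (hN : 0 < N) {F : Filter ι} :
    Tendsto (fun i => √(2 * N * |t i|)) (comap t atBot ⊓ F) atTop := by
  refine Tendsto.mono_left ?_ inf_le_left
  refine Real.tendsto_sqrt_atTop.comp (Tendsto.const_mul_atTop (by positivity) ?_)
  exact tendsto_abs_atBot_atTop.comp tendsto_comap

theorem tendsto_inv_smul_of_norm_le {ι E : Type*} [NormedAddCommGroup E] [NormedSpace ℝ E]
    {l : Filter ι} {r : ι → ℝ} {b : ι → E} {K : ℝ} (hr : Tendsto r l atTop)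
    (hb : ∀ᶠ i in l, ‖b i‖ ≤ K) : Tendsto (fun i => (r i)⁻¹ • b i) l (𝓝 0) := by
  refine squeeze_zero_norm' (a := fun i => ‖(r i)⁻¹‖ * K) ?_ ?_
  · filter_upwards [hb] with i hi
    rw [norm_smul]
    gcongr
  · simpa using (tendsto_inv_atTop_zero.comp hr).norm.mul_const K

/-- Cylindrical flows converge to the shrinking cylinder under parabolic rescaling as `t → -∞`,
uniformly if the extinction time and the distance of the axis from the center are bounded. -/
theorem cylinder_eventually {n : ℕ} (hn : 2 ≤ n) {ε K : ℝ} (hε : 0 < ε) :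
    ∃ T₀ : ℝ, 0 < T₀ ∧ ∀ i : CylinderView n,
      (‖i.w‖ = 1 ∧ |i.T| ≤ 15 ∧ ‖radialPart i.w (i.p - i.q)‖ ≤ K) → i.t ≤ -T₀ →
      IsCloseToCylinder n ε i.w fun s => (fun x => (√(2 * ((n : ℝ) - 1) * |i.t|))⁻¹ • (x - i.p)) ''
        {x | i.t + √(2 * ((n : ℝ) - 1) * |i.t|) ^ 2 * s < i.T ∧ x - i.q ∈ roundCylinder i.w
          √(2 * ((n : ℝ) - 1) * (i.T - (i.t + √(2 * ((n : ℝ) - 1) * |i.t|) ^ 2 * s)))} := by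
  have hN : (1 : ℝ) ≤ (n : ℝ) - 1 := by
    have : (2 : ℝ) ≤ n := by exact_mod_cast hn
    linarith
  refine exists_time_of_eventually ?_
  set N : ℝ := (n : ℝ) - 1
  set l : Filter (CylinderView n) := comap CylinderView.t atBot ⊓ 𝓟 {i |
    ‖i.w‖ = 1 ∧ |i.T| ≤ 15 ∧ ‖radialPart i.w (i.p - i.q)‖ ≤ K}
  have hl : ∀ᶠ i in l, ‖i.w‖ = 1 ∧ |i.T| ≤ 15 ∧ ‖radialPart i.w (i.p - i.q)‖ ≤ K :=
    mem_inf_of_right (mem_principal_self _)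
  set r : CylinderView n → ℝ := fun i => √(2 * N * |i.t|) with hrdef
  have hr : Tendsto r l atTop := tendsto_scale (by linarith)
  have ht : ∀ᶠ i in l, i.t < -15 :=
    (tendsto_comap.mono_left inf_le_left).eventually_lt_atBot (-15)
  refine eventually_isCloseToCylinder hn hε (w := fun i => i.w)
    (a := fun i => (r i)⁻¹ • radialPart i.w (i.p - i.q))
    (κ := fun i => (r i ^ 2)⁻¹ • i.T) (μ := fun _ => 0) (e := fun _ _ => 0)
    (hl.mono fun i hi => hi.1)
    (hl.mono fun i hi => by rw [inner_smul_right, inner_radialPart hi.1, mul_zero])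
    (tendsto_inv_smul_of_norm_le hr (hl.mono fun i hi => hi.2.2))
    (tendsto_inv_smul_of_norm_le ((tendsto_pow_atTop two_ne_zero).comp hr)
      (hl.mono fun i hi => hi.2.1)) tendsto_const_nhds ?_ ?_
  · intro k η hη
    refine Eventually.of_forall fun i t _ => ⟨contDiffAt_const, fun j _ => ?_⟩
    simpa [iteratedDeriv_const] using hη.le
  · filter_upwards [hl, ht, hr.eventually_gt_atTop 0] with i h1 h2 h3 s hs x _
    have h4 : r i ^ 2 = 2 * N * -i.t := by
      rw [hrdef]
      simp only
      rw [Real.sq_sqrt (by positivity), abs_of_neg (by linarith)]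
    have h5 : i.t + r i ^ 2 * s < i.T := by
      have := (abs_le.1 h1.2.1).1
      nlinarith [hs.2, sq_nonneg (r i)]
    rw [mem_rescale_iff h3]
    change (i.t + r i ^ 2 * s < i.T ∧ ‖radialPart i.w (r i • x + i.p - i.q)‖ =
      √(2 * N * (i.T - (i.t + r i ^ 2 * s)))) ↔ _
    rw [and_iff_right h5]
    have h6 : radialPart i.w (r i • x + i.p - i.q) =
        r i • (radialPart i.w x + (r i)⁻¹ • radialPart i.w (i.p - i.q)) := by
      rw [add_sub_assoc, radialPart_add, radialPart_smul, smul_add, smul_smul,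
        mul_inv_cancel₀ h3.ne', one_smul]
    rw [h6, norm_smul, Real.norm_of_nonneg h3.le, eq_comm,
      Real.sqrt_eq_iff_eq_sq (mul_nonneg (by linarith) (by linarith)) (by positivity), mul_pow,
      sectionSq, smul_eq_mul]
    have h7 : 2 * N * (i.T - (i.t + r i ^ 2 * s)) =
        r i ^ 2 * (1 - 2 * N * s + 2 * N * (0 * inner ℝ i.w x + (r i ^ 2)⁻¹ * i.T) + 0) := by
      have : r i ^ 2 ≠ 0 := by positivity
      field_simp
      rw [h4]
      ring
    rw [h7, mul_right_inj' (by positivity), eq_comm]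

/-- Bowl solitons converge to the shrinking cylinder under parabolic rescaling as `t → -∞`,
uniformly if the speed is bounded below, the tip passes the height of the center at a bounded time,
and the distance of the axis from the center is bounded. -/
theorem bowl_eventually {n : ℕ} (hn : 2 ≤ n) {χ : ℝ → ℝ} (hχ : IsBowlCurve n χ) {ε K : ℝ}
    (hε : 0 < ε) :
    ∃ T₀ : ℝ, 0 < T₀ ∧ ∀ i : BowlView n,
      (‖i.w‖ = 1 ∧ IsBowlProfile n i.c i.φ ∧ 1 ≤ i.c ∧
        |inner ℝ i.w (i.p - i.q) - i.φ 0| ≤ 15 * i.c ∧ ‖radialPart i.w (i.p - i.q)‖ ≤ K) →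
      i.t ≤ -T₀ →
      IsCloseToCylinder n ε i.w fun s => (fun x => (√(2 * ((n : ℝ) - 1) * |i.t|))⁻¹ • (x - i.p)) ''
        {x | inner ℝ i.w (x - i.q) = i.φ ‖radialPart i.w (x - i.q)‖ +
          i.c * (i.t + √(2 * ((n : ℝ) - 1) * |i.t|) ^ 2 * s)} := by
  have hN : (1 : ℝ) ≤ (n : ℝ) - 1 := by
    have : (2 : ℝ) ≤ n := by exact_mod_cast hn
    linarith
  refine exists_time_of_eventually ?_
  set l : Filter (BowlView n) := comap BowlView.t atBot ⊓ 𝓟 {i |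
    ‖i.w‖ = 1 ∧ IsBowlProfile n i.c i.φ ∧ 1 ≤ i.c ∧
        |inner ℝ i.w (i.p - i.q) - i.φ 0| ≤ 15 * i.c ∧ ‖radialPart i.w (i.p - i.q)‖ ≤ K}
  have hl : ∀ᶠ i in l, ‖i.w‖ = 1 ∧ IsBowlProfile n i.c i.φ ∧ 1 ≤ i.c ∧
        |inner ℝ i.w (i.p - i.q) - i.φ 0| ≤ 15 * i.c ∧ ‖radialPart i.w (i.p - i.q)‖ ≤ K :=
    mem_inf_of_right (mem_principal_self _)
  set N : ℝ := (n : ℝ) - 1 with hNdef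
  set r : BowlView n → ℝ := fun i => √(2 * N * |i.t|) with hrdef
  have hr : Tendsto r l atTop := tendsto_scale (by linarith)
  have ht : ∀ᶠ i in l, i.t < 0 :=
    (tendsto_comap.mono_left inf_le_left).eventually_lt_atBot 0
  set H : BowlView n → ℝ := fun i => inner ℝ i.w (i.p - i.q) - i.φ 0 with hH
  have hμ : Tendsto (fun i => (r i)⁻¹ • (i.c)⁻¹) l (𝓝 0) :=
    tendsto_inv_smul_of_norm_le (K := 1) hr (hl.mono fun i hi => by
      rw [norm_inv, Real.norm_of_nonneg (by linarith [hi.2.2.1])]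
      exact inv_le_one_of_one_le₀ hi.2.2.1)
  have hμ' : Tendsto (fun i => (r i)⁻¹ • (i.c)⁻¹) l (𝓝[>] 0) := by
    refine tendsto_nhdsWithin_iff.2 ⟨hμ, ?_⟩
    filter_upwards [hl, hr.eventually_gt_atTop 0] with i h1 h2
    have : 0 < i.c := by linarith [h1.2.2.1]
    exact mul_pos (inv_pos.2 h2) (inv_pos.2 this)
  have hκ : Tendsto (fun i => (r i ^ 2)⁻¹ • ((i.c)⁻¹ * H i)) l (𝓝 0) :=
    tendsto_inv_smul_of_norm_le (K := 15) ((tendsto_pow_atTop two_ne_zero).comp hr)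
      (hl.mono fun i hi => by
        have hc : 0 < i.c := by linarith [hi.2.2.1]
        rw [norm_mul, norm_inv, Real.norm_of_nonneg hc.le, inv_mul_le_iff₀ hc, mul_comm]
        exact hi.2.2.2.1)
  have hτ : Tendsto (fun i => |(r i)⁻¹ • (i.c)⁻¹| * ε⁻¹ + |(r i ^ 2)⁻¹ • ((i.c)⁻¹ * H i)|) l
      (𝓝 0) := by
    simpa using (hμ.abs.mul_const ε⁻¹).add hκ.abs
  refine eventually_isCloseToCylinder hn hε (w := fun i => i.w)
    (a := fun i => (r i)⁻¹ • radialPart i.w (i.p - i.q))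
    (κ := fun i => (r i ^ 2)⁻¹ • ((i.c)⁻¹ * H i)) (μ := fun i => (r i)⁻¹ • (i.c)⁻¹)
    (e := fun i τ => ((r i)⁻¹ • (i.c)⁻¹) ^ 2 *
      heightError n χ ((((r i)⁻¹ • (i.c)⁻¹) ^ 2)⁻¹ * τ))
    (hl.mono fun i hi => hi.1)
    (hl.mono fun i hi => by rw [inner_smul_right, inner_radialPart hi.1, mul_zero])
    (tendsto_inv_smul_of_norm_le hr (hl.mono fun i hi => hi.2.2.2.2)) hκ hμ ?_ ?_
  · intro k η hη
    have h1 : ∀ᶠ μ in 𝓝[>] (0 : ℝ), ∀ j ∈ Iic k, ∀ τ ∈ Icc (1 / (4 * N)) 3,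
        |iteratedDeriv j (fun τ => μ ^ 2 * heightError n χ ((μ ^ 2)⁻¹ * τ)) τ| ≤ η :=
      (eventually_all_finite (finite_Iic k)).2 fun j _ =>
        hχ.rescaled_heightError_small hn j (by positivity) hη
    filter_upwards [hμ'.eventually h1, hμ'.eventually self_mem_nhdsWithin] with i h2 h3 τ hτ'
    refine ⟨?_, fun j hj => h2 j hj τ hτ'⟩
    have h3 : 0 < (r i)⁻¹ • (i.c)⁻¹ := h3
    have h4 : 0 < τ := lt_of_lt_of_le (by positivity) hτ'.1
    have h5 := (hχ.contDiffOn_heightError (n := n)).contDiffAt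
      (Ioi_mem_nhds (show 0 < (((r i)⁻¹ • (i.c)⁻¹) ^ 2)⁻¹ * τ by positivity))
    exact contDiffAt_const.mul ((h5.of_le (by exact_mod_cast le_top)).comp τ
      (contDiffAt_const.mul contDiffAt_id))
  · filter_upwards [hl, ht, hr.eventually_gt_atTop 0,
      hτ.eventually_lt_const (show (0 : ℝ) < 1 / (2 * N) by positivity)] with i h1 h2 h3 h4 s hs x hx
    obtain ⟨hw, hφ, hc1, -, -⟩ := h1
    have hc : 0 < i.c := hφ.speed_pos
    have hr2 : r i ^ 2 = 2 * N * -i.t := by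
      rw [hrdef]
      simp only
      rw [Real.sq_sqrt (by positivity), abs_of_neg h2]
    set μ := (r i)⁻¹ • (i.c)⁻¹ with hμdef
    set κ := (r i ^ 2)⁻¹ • ((i.c)⁻¹ * H i) with hκdef
    set z : ℝ := inner ℝ i.w x with hz
    have hz1 : |z| ≤ ε⁻¹ := by
      have := abs_real_inner_le_norm i.w x
      rw [hw, one_mul] at this
      exact this.trans hx.le
    -- `τ` is the height above the tip, after rescaling to unit speed and multiplication by `μ²`.
    set τ := 1 / (2 * N) - s + (μ * z + κ) with hτdef
    have hτ0 : 0 < τ := by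
      have g1 : |μ * z + κ| < 1 / (2 * N) := by
        refine lt_of_le_of_lt ((abs_add_le _ _).trans ?_) h4
        rw [abs_mul]
        gcongr
      linarith [(abs_lt.1 g1).1, hs.2]
    have hμ0 : 0 < μ := mul_pos (inv_pos.2 h3) (inv_pos.2 hc)
    have hy0 : 0 < (μ ^ 2)⁻¹ * τ := by positivity
    have h6 : radialPart i.w (r i • x + i.p - i.q) =
        r i • (radialPart i.w x + (r i)⁻¹ • radialPart i.w (i.p - i.q)) := by
      rw [add_sub_assoc, radialPart_add, radialPart_smul, smul_add, smul_smul,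
        mul_inv_cancel₀ h3.ne', one_smul]
    set d := ‖radialPart i.w x + (r i)⁻¹ • radialPart i.w (i.p - i.q)‖ with hd
    have hd0 : 0 ≤ d := norm_nonneg _
    have hμinv : i.c * (r i * d) = μ⁻¹ * d := by
      rw [hμdef, smul_eq_mul, mul_inv, inv_inv, inv_inv]
      ring
    have hyeq : (μ ^ 2)⁻¹ * τ = i.c * (r i * z + H i - i.c * (i.t + r i ^ 2 * s)) := by
      have hr2' : 1 / (2 * N) = -i.t / r i ^ 2 := by
        rw [hr2]
        have : i.t ≠ 0 := h2.ne
        field_simp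
      rw [hτdef, hr2', hμdef, hκdef, smul_eq_mul, smul_eq_mul]
      field_simp
      ring
    have hstep : inner ℝ i.w (r i • x + i.p - i.q) =
        i.φ ‖radialPart i.w (r i • x + i.p - i.q)‖ + i.c * (i.t + r i ^ 2 * s) ↔
        χ (μ⁻¹ * d) = (μ ^ 2)⁻¹ * τ := by
      rw [h6, norm_smul, Real.norm_of_nonneg h3.le, hφ.eq_rescaled hn hχ (by positivity), hμinv,
        add_sub_assoc, inner_add_right, inner_smul_right, hyeq, ← hz,
        mul_comm i.c (r i * z + H i - i.c * (i.t + r i ^ 2 * s)), ← div_eq_iff hc.ne', hH]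
      constructor <;> intro <;> linarith
    rw [mem_rescale_iff h3, mem_ofPred_eq, hstep, hχ.apply_eq_iff (by positivity) hy0.le]
    have hF : heightRadius χ ((μ ^ 2)⁻¹ * τ) ^ 2 =
        2 * N * ((μ ^ 2)⁻¹ * τ) + heightError n χ ((μ ^ 2)⁻¹ * τ) := by
      rw [heightError]; ring
    have hsec : sectionSq N κ μ (fun τ => μ ^ 2 * heightError n χ ((μ ^ 2)⁻¹ * τ)) s z =
        μ ^ 2 * (2 * N * ((μ ^ 2)⁻¹ * τ) + heightError n χ ((μ ^ 2)⁻¹ * τ)) := by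
      have : 2 * N * τ = 1 - 2 * N * s + 2 * N * (μ * z + κ) := by
        rw [hτdef]; field_simp
      rw [sectionSq, ← hτdef, ← this]
      field_simp
    rw [hF, hsec, mul_pow, inv_pow, inv_mul_eq_iff_eq_mul₀ (by positivity)]

theorem proposition7p1 (n : ℕ) (hn : 2 ≤ n) :
    ∃ δbar : ℝ, 0 < δbar ∧
      ∀ δ₀ δ₁ : ℝ, 0 < δ₀ → δ₀ ≤ δbar → 0 < δ₁ → δ₁ ≤ δbar →
        ∃ 𝒯 : ℝ, 0 < 𝒯 ∧
          ∀ (M : ℝ → Set (Euc (n + 1))) (p : Euc (n + 1)),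
            (IsCylinderFlow n M ∨ IsBowlFlow n M) →
            HasStrongNeck n δ₀ M p √(2 * ((n : ℝ) - 1)) (-1) →
            ∀ t : ℝ, t ≤ -𝒯 →
              HasStrongNeck n δ₁ M p √(2 * ((n : ℝ) - 1) * |t|) t := by
  have hn' : (2 : ℝ) ≤ n := by exact_mod_cast hn
  refine ⟨1 / 100, by norm_num, fun δ₀ δ₁ hδ₀ hδ₀' hδ₁ _ => ?_⟩
  have hpos : ∀ t : ℝ, t < 0 → 0 < √(2 * ((n : ℝ) - 1) * |t|) := fun t ht =>
    Real.sqrt_pos.2 (mul_pos (by linarith) (abs_pos.2 ht.ne))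
  obtain ⟨T₁, hT₁, h₁⟩ := cylinder_eventually hn (K := 2 * √(2 * ((n : ℝ) - 1))) hδ₁
  -- If there is a bowl soliton at all, it is unique up to scaling and rigid motions.
  obtain ⟨T₂, hT₂, h₂⟩ : ∃ T₂ : ℝ, 0 < T₂ ∧ ∀ (M : ℝ → Set (Euc (n + 1))) (p : Euc (n + 1)),
      IsBowlFlow n M → HasStrongNeck n δ₀ M p √(2 * ((n : ℝ) - 1)) (-1) →
      ∀ t : ℝ, t ≤ -T₂ → HasStrongNeck n δ₁ M p √(2 * ((n : ℝ) - 1) * |t|) t := by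
    by_cases hex : ∃ χ, IsBowlCurve n χ
    · obtain ⟨χ, hχ⟩ := hex
      obtain ⟨T₂, hT₂, h₂⟩ := bowl_eventually hn hχ (K := 2 * √(2 * ((n : ℝ) - 1))) hδ₁
      refine ⟨T₂, hT₂, fun M p hM hneck t ht => ?_⟩
      obtain ⟨c, φ, q, w, hφ, hw, hMt⟩ := hM
      obtain ⟨b1, b2, b3⟩ := hneck.bowl_control hn hδ₀ hδ₀' hw hφ hχ hMt
      refine ⟨hpos t (by linarith), w, hw, ?_⟩
      simp only [hMt]
      exact h₂ ⟨c, φ, q, w, p, t⟩ ⟨hw, hφ, b1, b2, b3⟩ ht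
    · exact ⟨1, one_pos, fun M p ⟨c, φ, q, w, hφ, _⟩ => (hex ⟨_, hφ.isBowlCurve hn⟩).elim⟩
  refine ⟨max T₁ T₂, lt_max_of_lt_left hT₁, fun M p hM hneck t ht => ?_⟩
  have ht₁ : t ≤ -T₁ := by linarith [le_max_left T₁ T₂]
  have ht₂ : t ≤ -T₂ := by linarith [le_max_right T₁ T₂]
  rcases hM with ⟨T, q, w, hw, hMt⟩ | hM
  · obtain ⟨b1, b2⟩ := hneck.cylinder_control hn hδ₀ hδ₀' hw hMt
    refine ⟨hpos t (by linarith), w, hw, ?_⟩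
    simp only [hMt]
    exact h₁ ⟨T, q, w, p, t⟩ ⟨hw, b1, b2⟩ ht₁
  · exact h₂ M p hM hneck t ht₂
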